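/- Let $k$ be a field of characteristic $0$ with a nonarchimedean absolute value $|\cdot|$ (for instance a complete discrete valuation field of mixed characteristic), and let $0<\gamma<1$. Let $A_{\gamma,x}=A_\gamma[x^{-1}]\subset k((x))$, where $A_\gamma$ is the ring of power series $\sum_{i\ge 0} a_ix^i$ over $k$ with $|a_i|\gamma^i\to 0$. For $0<\rho\le\gamma$ let $|\sum_i a_ix^i|_\rho=\sup_i|a_i|\rho^i$ be the $\rho$-Gauss norm on $A_{\gamma,x}$ and $v_\rho=-\log|\cdot|_\rho$. Let $\ell=\sum_{i=0}^n a_iT^i$ be a monic twisted polynomial of degree $n\ge 1$ with coefficients $a_i\in A_{\gamma,x}$, where $Ta=aT+\frac{da}{dx}$. The Newton polygon $\mathrm{NP}_\rho(\ell)$ is the lower boundary of the convex hull of the points $(-i,v_\rho(a_i))$, $0\le i\le n$ (points with $a_i=0$ lie at infinity). Its breaks are $-n$, $0$ and all integers $-n<m<0$ such that its slope on $[m-1,m]$ is strictly smaller than its slope on $[m,m+1]$. A slope of $\mathrm{NP}_\rho(\ell)$ is effective if it is $<\log\rho$. For $a_i\ne 0$ write $a_i=b_ix^{\mathrm{ord}_x(a_i)}+(\text{terms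 of higher degree})$ with $b_i\in k^\times$. The formal slopes of a differential module of rank $n$ over $(k((x)),\frac{d}{dx})$ are the $n$ rational numbers obtained as follows: over $\overline{k}((x^{1/N}))$ for a suitable $N\ge 1$ the module is a successive extension of modules of rank one (Turrittin--Levelt), and a module of rank one with generator $e$, $De=fe$, contributes the slope $\max\{0,-1-\mathrm{ord}_x(f)\}$. Let $\beta_1\ge\cdots\ge\beta_n$ be the formal slopes of $k((x))\{T\}/k((x))\{T\}\ell$. There exists a real number $c$ with $0<c\le\gamma$ such that for all $\rho\in(0,c]$ the following conditions hold, where all indices run only over those $i$ with $a_i\neq 0$: (i) $|a_i|_\rho=|b_i|\rho^{\mathrm{ord}_x(a_i)}$ for $0\le i\le n$; (ii) $\left|\dfrac{\log\left(\left|b_j/b_h\right|^{1/(j-h)}\cdot\left|b_h/b_l\right|^{1/(l-h)}\right)}{-\log\rho}\right|<\dfrac1{n^2+1}$ for $0\le h<j\le l\le n$; (iii) $\left|\dfrac{\log\left|b_l/b_j\right|^{1/(l-j)}}{-\log\rho}\right|<\dfrac1{n+1}$ for $0\le j<l\le n$. For every such $c$ the following hold. (1) For every $\rho\in(0,c]$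 the polygons $\mathrm{NP}_\rho(\ell)$ and $\mathrm{NP}_c(\ell)$ have the same breaks. (2) Let $-n=m_0<m_1<\cdots<m_r=0$ be the breaks of $\mathrm{NP}_c(\ell)$, and let $t$ be such that the slope of $\mathrm{NP}_c(\ell)$ on $[m_t,m_{t+1}]$ is effective. Then for every $s\in\{0,1,\dots,t\}$ the coefficients $a_{-m_s}$ and $a_{-m_{s+1}}$ are nonzero and $$\beta_{m_s-m_0+1}=\cdots=\beta_{m_{s+1}-m_0}=-1-\frac{\mathrm{ord}_x(a_{-m_{s+1}})-\mathrm{ord}_x(a_{-m_s})}{m_{s+1}-m_s}.$$ -/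

import Mathlib

open scoped TensorProduct Polynomial

noncomputable section

namespace DiffMod

/-! ### Differential rings and twisted polynomials -/

/-- A derivation of the commutative ring `R`: an additive map satisfying the Leibniz rule. The
pair `(R, d)` is a differential ring. -/
structure AddDerivation (R : Type*) [CommRing R] extends R →+ R where
  leibniz : ∀ a b : R, toFun (a * b) = a * toFun b + b * toFun a

namespace AddDerivation

variable {R : Type*} [CommRing R]

instance : FunLike (AddDerivation R) R R where
  coe d := d.toFun
  coe_injective := by
    intro d d' h
    cases d
    cases d'
    congr
    exact DFunLike.coe_injective h

instance : AddMonoidHomClass (AddDerivation R) R R where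
  map_add d := d.map_add'
  map_zero d := d.map_zero'

theorem apply_mul (d : AddDerivation R) (a b : R) : d (a * b) = a * d b + b * d a := d.leibniz a b

theorem apply_one (d : AddDerivation R) : d 1 = 0 := by
  have h := d.apply_mul 1 1
  rw [mul_one, one_mul] at h
  exact left_eq_add.mp h

end AddDerivation

section Twisted

variable {R : Type*} [CommRing R] (d : AddDerivation R)

/-- The ring `R{T}` of twisted polynomials `∑ aᵢ Tⁱ` over the differential ring `(R, d)`. The
underlying `R`-module is that of the polynomials over `R`; the multiplication is determined by
`T * a = a * T + d a`. -/
def TwistedPolynomial {R : Type*} [CommRing R] (_d : AddDerivation R) : Type _ := R[X]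

namespace TwistedPolynomial

instance : AddCommGroup (TwistedPolynomial d) := inferInstanceAs (AddCommGroup R[X])

instance : Module R (TwistedPolynomial d) := inferInstanceAs (Module R R[X])

/-- The polynomial `∑ aᵢ tⁱ` with the same coefficients as the twisted polynomial `∑ aᵢ Tⁱ`. -/
def toPoly : TwistedPolynomial d ≃ₗ[R] R[X] := LinearEquiv.refl R R[X]

/-- The coefficient `aᵢ` of `∑ aᵢ Tⁱ`. -/
def coeff {d : AddDerivation R} (p : TwistedPolynomial d) (i : ℕ) : R := (toPoly d p).coeff i

/-- The degree in `T`. -/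
def natDegree {d : AddDerivation R} (p : TwistedPolynomial d) : ℕ := (toPoly d p).natDegree

/-- The coefficient of the highest power of `T` is `1`. -/
def Monic {d : AddDerivation R} (p : TwistedPolynomial d) : Prop := (toPoly d p).Monic

/-- Apply `d` to every coefficient. -/
def dCoeff : R[X] →+ R[X] where
  toFun p := p.sum fun i a => Polynomial.monomial i (d a)
  map_zero' := Polynomial.sum_zero_index _
  map_add' p q := Polynomial.sum_add_index p q _ (by simp) (by simp)

theorem dCoeff_monomial (i : ℕ) (a : R) :
    dCoeff d (Polynomial.monomial i a) = Polynomial.monomial i (d a) :=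
  Polynomial.sum_monomial_index a (fun i a => Polynomial.monomial i (d a)) (by simp)

/-- Left multiplication by `T`: it sends `∑ aᵢ Tⁱ` to `∑ (aᵢ Tⁱ⁺¹ + d(aᵢ) Tⁱ)`. -/
def mulT : AddMonoid.End R[X] := AddMonoidHom.mulLeft Polynomial.X + dCoeff d

theorem mulT_monomial (i : ℕ) (a : R) :
    mulT d (Polynomial.monomial i a) =
      Polynomial.monomial (i + 1) a + Polynomial.monomial i (d a) := by
  have h : mulT d (Polynomial.monomial i a) =
    Polynomial.X * Polynomial.monomial i a + dCoeff d (Polynomial.monomial i a) := rfl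
  rw [h, dCoeff_monomial, Polynomial.X_mul_monomial]

/-- Left multiplication by `∑ aᵢ Tⁱ`, namely `∑ aᵢ • (mulT)ⁱ`. -/
def mulEnd : R[X] →+ AddMonoid.End R[X] :=
  Polynomial.eval₂AddMonoidHom (Module.toAddMonoidEnd R R[X]) (mulT d)

theorem mulEnd_monomial (i : ℕ) (a : R) :
    mulEnd d (Polynomial.monomial i a) = Module.toAddMonoidEnd R R[X] a * mulT d ^ i :=
  Polynomial.eval₂_monomial _ _

theorem mulT_comp_smul (a : R) :
    mulT d * Module.toAddMonoidEnd R R[X] a =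
      Module.toAddMonoidEnd R R[X] a * mulT d + Module.toAddMonoidEnd R R[X] (d a) := by
  refine Polynomial.addHom_ext fun i b => ?_
  change mulT d (a • Polynomial.monomial i b) =
    a • mulT d (Polynomial.monomial i b) + d a • Polynomial.monomial i b
  rw [Polynomial.smul_monomial, mulT_monomial, mulT_monomial, smul_add,
    Polynomial.smul_monomial, Polynomial.smul_monomial, Polynomial.smul_monomial, add_assoc,
    ← map_add]
  simp [d.apply_mul, mul_comm]

theorem mulEnd_mulT (q : R[X]) : mulEnd d (mulT d q) = mulT d * mulEnd d q := by
  induction q using Polynomial.induction_on' with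
  | add p q hp hq => rw [map_add, map_add, map_add, hp, hq, mul_add]
  | monomial i a =>
    rw [mulT_monomial, map_add, mulEnd_monomial, mulEnd_monomial, mulEnd_monomial, ← mul_assoc,
      mulT_comp_smul, add_mul, pow_succ', mul_assoc]

theorem mulEnd_smul (a : R) (q : R[X]) :
    mulEnd d (a • q) = Module.toAddMonoidEnd R R[X] a * mulEnd d q := by
  induction q using Polynomial.induction_on' with
  | add p q hp hq => rw [smul_add, map_add, map_add, hp, hq, mul_add]
  | monomial i b =>
    rw [Polynomial.smul_monomial, mulEnd_monomial, mulEnd_monomial, smul_eq_mul, map_mul,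
      mul_assoc]

theorem mulEnd_mulEnd (p q : R[X]) : mulEnd d (mulEnd d p q) = mulEnd d p * mulEnd d q := by
  induction p using Polynomial.induction_on' with
  | add p₁ p₂ h₁ h₂ =>
    have e : mulEnd d (p₁ + p₂) q = mulEnd d p₁ q + mulEnd d p₂ q :=
      DFunLike.congr_fun ((mulEnd d).map_add p₁ p₂) q
    rw [e, map_add, map_add, h₁, h₂, add_mul]
  | monomial i a =>
    rw [mulEnd_monomial]
    change mulEnd d (a • (mulT d ^ i) q) = _
    rw [mulEnd_smul, mul_assoc]
    congr 1
    induction i with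
    | zero => simp
    | succ i ih =>
      rw [pow_succ']
      change mulEnd d (mulT d ((mulT d ^ i) q)) = _
      rw [mulEnd_mulT, ih, mul_assoc]

theorem mulEnd_one : mulEnd d 1 = 1 := by
  have h := mulEnd_monomial d 0 1
  rw [pow_zero, mul_one, (Module.toAddMonoidEnd R R[X]).map_one] at h
  exact h

theorem mulEnd_apply_one (p : R[X]) : mulEnd d p 1 = p := by
  induction p using Polynomial.induction_on' with
  | add p q hp hq =>
    rw [map_add]
    exact congrArg₂ (· + ·) hp hq
  | monomial i a =>
    rw [mulEnd_monomial]
    change a • (mulT d ^ i) 1 = _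
    have h : (mulT d ^ i) (1 : R[X]) = Polynomial.monomial i 1 := by
      induction i with
      | zero => rfl
      | succ i ih =>
        rw [pow_succ']
        change mulT d ((mulT d ^ i) 1) = _
        rw [ih, mulT_monomial]
        simp [d.apply_one]
    rw [h, Polynomial.smul_monomial, smul_eq_mul, mul_one]

instance : Ring (TwistedPolynomial d) where
  __ := (inferInstance : AddCommGroup (TwistedPolynomial d))
  mul p q := mulEnd d p q
  one := (1 : R[X])
  left_distrib p q r := (mulEnd d p).map_add q r
  right_distrib p q r := DFunLike.congr_fun ((mulEnd d).map_add p q) r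
  zero_mul p := DFunLike.congr_fun (mulEnd d).map_zero p
  mul_zero p := (mulEnd d p).map_zero
  mul_assoc p q r := DFunLike.congr_fun (mulEnd_mulEnd d p q) r
  one_mul p := DFunLike.congr_fun (mulEnd_one d) p
  mul_one p := mulEnd_apply_one d p

instance : IsScalarTower R (TwistedPolynomial d) (TwistedPolynomial d) where
  smul_assoc a p q := DFunLike.congr_fun (mulEnd_smul d a p) q

/-- The variable `T`. -/
def T : TwistedPolynomial d := (toPoly d).symm Polynomial.X

theorem T_mul_smul (a : R) (p : TwistedPolynomial d) :
    T d * (a • p) = a • (T d * p) + d a • p := by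
  have h : mulEnd d Polynomial.X = mulT d := by
    have h := mulEnd_monomial d 1 1
    rwa [pow_one, (Module.toAddMonoidEnd R R[X]).map_one, one_mul] at h
  change mulEnd d Polynomial.X (a • toPoly d p) =
    a • mulEnd d Polynomial.X (toPoly d p) + d a • toPoly d p
  rw [h]
  exact DFunLike.congr_fun (mulT_comp_smul d a) p

end TwistedPolynomial

end Twisted

/-! ### Differential modules -/

/-- A differential operator on the `R`-module `M` relative to the derivation `d` of `R`; an
`R`-module together with such an operator is a differential module over `(R, d)`. -/
structure DifferentialOperator {R : Type*} [CommRing R] (d : AddDerivation R)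
    (M : Type*) [AddCommGroup M] [Module R M] extends M →+ M where
  leibniz : ∀ (a : R) (m : M), toFun (a • m) = a • toFun m + d a • m

/-- The left `R{T}`-module `R{T} / R{T}ℓ`. -/
abbrev CyclicModule {R : Type*} [CommRing R] {d : AddDerivation R}
    (ℓ : TwistedPolynomial d) : Type _ :=
  TwistedPolynomial d ⧸ Submodule.span (TwistedPolynomial d) {ℓ}

/-- Left multiplication by `T` makes `R{T} / R{T}ℓ` a differential module over `(R, d)`. -/
def cyclicOperator {R : Type*} [CommRing R] {d : AddDerivation R}
    (ℓ : TwistedPolynomial d) : DifferentialOperator d (CyclicModule ℓ) where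
  toFun m := TwistedPolynomial.T d • m
  map_zero' := smul_zero _
  map_add' := smul_add _
  leibniz a m := by
    obtain ⟨p, rfl⟩ := Submodule.Quotient.mk_surjective _ m
    exact congrArg (Submodule.Quotient.mk (p := Submodule.span (TwistedPolynomial d) {ℓ}))
      (TwistedPolynomial.T_mul_smul d a p)

/-- Base change of a differential module `(M, D)` along a morphism `(R, d) → (S, e)` of
differential rings: the operator `b ⊗ m ↦ e b ⊗ m + b ⊗ D m` on `S ⊗ M`. -/
def DifferentialOperator.baseChange {R S M : Type*} [CommRing R] [CommRing S] [Algebra R S]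
    [AddCommGroup M] [Module R M] {d : AddDerivation R} (D : DifferentialOperator d M)
    (e : AddDerivation S) (he : ∀ a : R, e (algebraMap R S a) = algebraMap R S (d a)) :
    DifferentialOperator e (S ⊗[R] M) where
  toAddMonoidHom := TensorProduct.liftAddHom
    (AddMonoidHom.mk' (fun b => AddMonoidHom.mk' (fun m => e b ⊗ₜ[R] m + b ⊗ₜ[R] D.toFun m)
        fun m m' => by
          have h : D.toFun (m + m') = D.toFun m + D.toFun m' := D.map_add' m m'
          rw [h, TensorProduct.tmul_add, TensorProduct.tmul_add]; abel)
      fun b b' => by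
        ext m
        simp only [AddMonoidHom.mk'_apply, AddMonoidHom.add_apply, map_add,
          TensorProduct.add_tmul]
        abel)
    fun a b m => by
      have h : D.toFun (a • m) = a • D.toFun m + d a • m := D.leibniz a m
      have h' : e (a • b) = a • e b + d a • b := by
        rw [Algebra.smul_def, AddDerivation.apply_mul, he, Algebra.smul_def, Algebra.smul_def,
          mul_comm b]
      simp only [AddMonoidHom.mk'_apply, h, h', TensorProduct.tmul_add, TensorProduct.add_tmul,
        TensorProduct.smul_tmul]
      abel
  leibniz b z := by
    induction z using TensorProduct.induction_on with
    | zero =>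
      have key : ∀ f : S ⊗[R] M →+ S ⊗[R] M,
          f (b • (0 : S ⊗[R] M)) = b • f 0 + e b • (0 : S ⊗[R] M) := by simp
      exact key _
    | tmul b' m =>
      change e (b * b') ⊗ₜ[R] m + (b * b') ⊗ₜ[R] D.toFun m =
        b • (e b' ⊗ₜ[R] m + b' ⊗ₜ[R] D.toFun m) + (e b * b') ⊗ₜ[R] m
      simp only [AddDerivation.apply_mul, smul_eq_mul, TensorProduct.add_tmul, smul_add,
        TensorProduct.smul_tmul', mul_comm b' (e b)]
      abel
    | add z z' h h' =>
      have key : ∀ (f : S ⊗[R] M →+ S ⊗[R] M),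
          f (b • z) = b • f z + e b • z → f (b • z') = b • f z' + e b • z' →
          f (b • (z + z')) = b • f (z + z') + e b • (z + z') := by
        intro f h₁ h₂
        rw [smul_add, map_add, h₁, h₂, map_add, smul_add, smul_add]
        abel
      exact key _ h h'

/-! ### Laurent series -/

theorem derivative_leibniz {F : Type*} [Field F] (f g : LaurentSeries F) :
    LaurentSeries.derivative F (f * g) =
      f * LaurentSeries.derivative F g + g * LaurentSeries.derivative F f := by
  -- the Euler operator `x d/dx` preserves supports
  let θ : LaurentSeries F → LaurentSeries F := fun h =>
    { coeff := fun n => (n : F) * h.coeff n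
      isPWO_support' := h.isPWO_support.mono fun n hn hz => hn (by
        change h.coeff n = 0 at hz
        simp [hz]) }
  have hsupp : ∀ h : LaurentSeries F, (θ h).support ⊆ h.support := fun h n hn hz => hn (by
    change h.coeff n = 0 at hz
    change (n : F) * h.coeff n = 0
    simp [hz])
  have hd : ∀ h : LaurentSeries F,
      LaurentSeries.derivative F h = HahnSeries.single (-1) (1 : F) * θ h := by
    intro h
    ext n
    rw [show n = (n + 1) + -1 by ring, HahnSeries.coeff_single_mul_add]
    simp [θ]
  have hθ : θ (f * g) = f * θ g + g * θ f := by
    ext n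
    rw [mul_comm g, HahnSeries.coeff_add, HahnSeries.coeff_mul_right' g.isPWO_support (hsupp g),
      HahnSeries.coeff_mul_left' f.isPWO_support (hsupp f), ← Finset.sum_add_distrib]
    change (n : F) * (f * g).coeff n = _
    rw [HahnSeries.coeff_mul, Finset.mul_sum]
    refine Finset.sum_congr rfl fun ij hij => ?_
    have hn : ij.1 + ij.2 = n := (Finset.mem_antidiagonal.mp hij).2.2
    change _ = f.coeff ij.1 * ((ij.2 : F) * g.coeff ij.2) + (ij.1 : F) * f.coeff ij.1 * g.coeff ij.2
    rw [← hn]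
    push_cast
    ring
  rw [hd, hd, hd, hθ]
  ring

/-- The derivation `d/dx` of the field `F((x))`. -/
def ddx (F : Type*) [Field F] : AddDerivation (LaurentSeries F) where
  toAddMonoidHom := (LaurentSeries.derivative F).toAddMonoidHom
  leibniz := derivative_leibniz

/-- The field `k̄((x^{1/N}))`, where `k̄` is an algebraic closure of `k`; it consists of the Laurent
series over `k̄` in the variable `t = x^{1/N}`. -/
def RamifiedField (k : Type*) [Field k] (_N : ℕ+) : Type _ := LaurentSeries (AlgebraicClosure k)

namespace RamifiedField

variable (k : Type*) [Field k] (N : ℕ+)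

instance : Field (RamifiedField k N) := inferInstanceAs (Field (LaurentSeries (AlgebraicClosure k)))

/-- The identification with Laurent series in `t = x^{1/N}`. -/
def toLaurent : RamifiedField k N ≃+* LaurentSeries (AlgebraicClosure k) := RingEquiv.refl _

/-- The inclusion `k((x)) → k̄((x))`. -/
def mapCoeff : LaurentSeries k →+* LaurentSeries (AlgebraicClosure k) where
  toFun f := f.map (algebraMap k (AlgebraicClosure k))
  map_zero' := by ext; simp
  map_one' := by
    ext n
    simp only [HahnSeries.map_coeff, HahnSeries.coeff_one]
    split <;> simp
  map_add' f g := by ext; simp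
  map_mul' f g :=
    HahnSeries.map_mul ((algebraMap k (AlgebraicClosure k)) : k →ₙ+* AlgebraicClosure k)

/-- The inclusion `k((x)) → k̄((t))`, `∑ aᵢ xⁱ ↦ ∑ aᵢ t^{N i}`. -/
def inclusion : LaurentSeries k →+* RamifiedField k N :=
  ((toLaurent k N).symm : LaurentSeries (AlgebraicClosure k) →+* RamifiedField k N).comp
    ((HahnSeries.embDomainRingHom (AddMonoidHom.mulLeft ((N : ℕ) : ℤ))
      (mul_right_injective₀ (by simp))
      fun _ _ => mul_le_mul_iff_of_pos_left (by simp)).comp (mapCoeff k))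

instance : Algebra (LaurentSeries k) (RamifiedField k N) := (inclusion k N).toAlgebra

/-- The derivation `d/dx = (N t^{N-1})⁻¹ d/dt` of `k̄((t))`, where `x = t^N`. -/
def ddx : AddDerivation (RamifiedField k N) where
  toFun f := (toLaurent k N).symm
    (HahnSeries.single (1 - ((N : ℕ) : ℤ)) ((N : ℕ) : AlgebraicClosure k)⁻¹ *
      DiffMod.ddx (AlgebraicClosure k) (toLaurent k N f))
  map_zero' := by simp
  map_add' f g := by simp [mul_add]
  leibniz f g := by
    apply (toLaurent k N).injective
    simp only [map_mul, map_add, RingEquiv.apply_symm_apply, AddDerivation.apply_mul]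
    ring

theorem ddx_algebraMap [CharZero k] (f : LaurentSeries k) :
    ddx k N (algebraMap (LaurentSeries k) (RamifiedField k N) f) =
      algebraMap (LaurentSeries k) (RamifiedField k N) (DiffMod.ddx k f) := by
  have hN : (((N : ℕ) : AlgebraicClosure k)) ≠ 0 := by
    have : CharZero (AlgebraicClosure k) :=
      charZero_of_injective_algebraMap (algebraMap k (AlgebraicClosure k)).injective
    simp
  have hN' : ((N : ℕ) : ℤ) ≠ 0 := by simp
  have hc : ∀ (g : LaurentSeries k) (i : ℤ),
      (toLaurent k N (algebraMap (LaurentSeries k) (RamifiedField k N) g)).coeff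
        (((N : ℕ) : ℤ) * i) = algebraMap k (AlgebraicClosure k) (g.coeff i) := fun g i =>
    HahnSeries.embDomain_coeff (a := i)
  have hc' : ∀ (g : LaurentSeries k) (n : ℤ), ¬ ((N : ℕ) : ℤ) ∣ n →
      (toLaurent k N (algebraMap (LaurentSeries k) (RamifiedField k N) g)).coeff n = 0 := by
    intro g n hn
    refine HahnSeries.embDomain_of_notMem_range ?_
    rintro ⟨i, rfl⟩
    exact hn ⟨i, rfl⟩
  apply (toLaurent k N).injective
  ext n
  have hl : (toLaurent k N (ddx k N (algebraMap (LaurentSeries k) (RamifiedField k N) f))).coeff n =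
      ((N : ℕ) : AlgebraicClosure k)⁻¹ * (((n + (N : ℕ) : ℤ) : AlgebraicClosure k) *
        (toLaurent k N (algebraMap (LaurentSeries k) (RamifiedField k N) f)).coeff
          (n + ((N : ℕ) : ℤ))) := by
    change (HahnSeries.single (1 - ((N : ℕ) : ℤ)) ((N : ℕ) : AlgebraicClosure k)⁻¹ *
      LaurentSeries.derivative (AlgebraicClosure k) (toLaurent k N
        (algebraMap (LaurentSeries k) (RamifiedField k N) f))).coeff n = _
    rw [show n = (n + (N : ℕ) - 1) + (1 - ((N : ℕ) : ℤ)) by ring, HahnSeries.coeff_single_mul_add]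
    simp
  rw [hl]
  by_cases hn : ((N : ℕ) : ℤ) ∣ n
  · obtain ⟨i, rfl⟩ := hn
    have h : (DiffMod.ddx k f).coeff i = ((i + 1 : ℤ) : k) * f.coeff (i + 1) := by
      change (LaurentSeries.derivative k f).coeff i = _
      simp
    rw [hc, h, show ((N : ℕ) : ℤ) * i + ((N : ℕ) : ℤ) = ((N : ℕ) : ℤ) * (i + 1) by ring, hc]
    push_cast
    field_simp
    simp [mul_comm]
  · rw [hc' _ _ hn, hc' _ _ (by simpa using hn)]
    simp

/-- The extension of `ord_x` to `k̄((x^{1/N}))`, for a nonzero element (at `0` the value is `0`). -/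
def ord (f : RamifiedField k N) : ℚ := ((toLaurent k N f).order : ℚ) / ((N : ℕ) : ℚ)

end RamifiedField

/-! ### Formal slopes -/

/-- The formal slope of the differential module of rank one with generator `e`, `D e = f e`, over
`(k̄((x^{1/N})), d/dx)`, namely `max (0, -1 - ord_x f)`; it is `0` for `f = 0`. -/
def rankOneSlope (k : Type*) [Field k] (N : ℕ+) (f : RamifiedField k N) : ℚ :=
  max 0 (-1 - RamifiedField.ord k N f)

/-- `s` is the multiset of formal slopes of the differential module `(M, D)` over
`(k((x)), d/dx)`: for some `N`, the base change of `M` to `k̄((x^{1/N}))` has a filtration by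
differential submodules with graded pieces of rank one (the existence of which is the theorem of
Turrittin and Levelt), and `s` consists of the slopes of the graded pieces. The filtration is
given by a basis `e₀, e₁, …`, its members being the spans of the initial segments of the basis,
and the `i`-th graded piece is generated by a vector `ē` with `D ē = fᵢ ē`. -/
def IsFormalSlopes {k : Type*} [Field k] [CharZero k] {M : Type*} [AddCommGroup M]
    [Module (LaurentSeries k) M] (D : DifferentialOperator (ddx k) M) (s : Multiset ℚ) : Prop :=
  ∃ (N : ℕ+) (r : ℕ)
    (e : Module.Basis (Fin r) (RamifiedField k N) (RamifiedField k N ⊗[LaurentSeries k] M))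
    (f : Fin r → RamifiedField k N),
    (∀ i, (D.baseChange (RamifiedField.ddx k N) (RamifiedField.ddx_algebraMap k N)).toFun (e i) -
        f i • e i ∈ Submodule.span (RamifiedField k N) (e '' Set.Iio i)) ∧
    s = Finset.univ.val.map fun i => rankOneSlope k N (f i)

/-! ### Analytic functions on the punctured disc and Gauss norms -/

section Analytic

variable {k : Type*} [NormedField k]

/-- The ring `A_{γ,x} = A_γ[x⁻¹]`, as a subring of `k((x))`, where `A_γ` is the ring of the power
series `∑ aᵢ xⁱ` over `k` with `|aᵢ| γⁱ → 0`. -/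
def analyticRing (k : Type*) [NormedField k] [IsUltrametricDist k] (γ : ℝ) :
    Subring (LaurentSeries k) where
  carrier := {f | ∃ (m : ℕ) (g : PowerSeries k), PowerSeries.IsRestricted γ g ∧
    f = HahnSeries.single (-(m : ℤ)) (1 : k) * HahnSeries.ofPowerSeries ℤ k g}
  zero_mem' := ⟨0, 0, PowerSeries.isRestricted_zero γ, by simp⟩
  one_mem' := ⟨0, 1, PowerSeries.isRestricted_one γ, by simp⟩
  neg_mem' := by
    rintro _ ⟨m, g, hg, rfl⟩
    exact ⟨m, -g, PowerSeries.isRestricted.neg γ hg, by simp⟩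
  mul_mem' := by
    rintro _ _ ⟨m, g, hg, rfl⟩ ⟨m', g', hg', rfl⟩
    refine ⟨m + m', g * g', PowerSeries.isRestricted.mul γ hg hg', ?_⟩
    have h : HahnSeries.single (-((m + m' : ℕ) : ℤ)) (1 : k) =
        HahnSeries.single (-(m : ℤ)) 1 * HahnSeries.single (-(m' : ℤ)) 1 := by
      rw [HahnSeries.single_mul_single, mul_one]
      push_cast
      ring_nf
    rw [h, RingHom.map_mul]
    ring
  add_mem' := by
    rintro _ _ ⟨m, g, hg, rfl⟩ ⟨m', g', hg', rfl⟩
    have hX : ∀ i : ℕ, PowerSeries.IsRestricted γ (PowerSeries.X ^ i : PowerSeries k) := by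
      intro i
      rw [PowerSeries.X_pow_eq]
      exact PowerSeries.isRestricted_monomial γ i 1
    refine ⟨m + m', PowerSeries.X ^ m' * g + PowerSeries.X ^ m * g',
      PowerSeries.isRestricted.add γ (PowerSeries.isRestricted.mul γ (hX m') hg)
        (PowerSeries.isRestricted.mul γ (hX m) hg'), ?_⟩
    have h : ∀ i j : ℕ, HahnSeries.single (-((i + j : ℕ) : ℤ)) (1 : k) *
        HahnSeries.single (j : ℤ) 1 = HahnSeries.single (-(i : ℤ)) 1 := by
      intro i j
      rw [HahnSeries.single_mul_single, mul_one]
      push_cast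
      ring_nf
    have h₂ := h m' m
    rw [add_comm m' m] at h₂
    rw [RingHom.map_add, RingHom.map_mul, RingHom.map_mul, HahnSeries.ofPowerSeries_X_pow,
      HahnSeries.ofPowerSeries_X_pow, mul_add, ← mul_assoc, ← mul_assoc, h m m', h₂]

/-- The `ρ`-Gauss norm `|∑ aᵢ xⁱ|_ρ = supᵢ |aᵢ| ρⁱ`; the supremum is finite on `A_{γ,x}` for
`0 < ρ ≤ γ`. -/
def gaussNorm (ρ : ℝ) (f : LaurentSeries k) : ℝ := ⨆ i : ℤ, ‖f.coeff i‖ * ρ ^ i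

/-! ### Newton polygons -/

/-- The points `(-i, v_ρ(aᵢ))` with `0 ≤ i ≤ n` and `v_ρ(aᵢ) = -log |aᵢ|_ρ < ∞`, for
`ℓ = ∑ aᵢ Tⁱ` of degree `n`. -/
def newtonPoints (ρ : ℝ) (ℓ : TwistedPolynomial (ddx k)) : Set (ℝ × ℝ) :=
  {P | ∃ i : ℕ, i ≤ ℓ.natDegree ∧ ℓ.coeff i ≠ 0 ∧
    P = (-(i : ℝ), -Real.log (gaussNorm ρ (ℓ.coeff i)))}

/-- The Newton polygon `NP_ρ(ℓ)`, i.e. the lower boundary of the convex hull of the points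
`(-i, v_ρ(aᵢ))`, as a function on `[-n, 0]`. Its value is `∞` where the vertical line does not meet
the convex hull; on `[-n, 0]` this happens only if `a₀ = 0`, between the last nonzero term
and `0`. -/
def newtonPolygon (ρ : ℝ) (ℓ : TwistedPolynomial (ddx k)) (y : ℝ) : EReal :=
  ⨅ z ∈ {z : ℝ | (y, z) ∈ convexHull ℝ (newtonPoints ρ ℓ)}, (z : EReal)

/-- The slope of `NP_ρ(ℓ)` on the interval `[u, w]`. -/
def newtonSlope (ρ : ℝ) (ℓ : TwistedPolynomial (ddx k)) (u w : ℤ) : EReal :=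
  (newtonPolygon ρ ℓ w - newtonPolygon ρ ℓ u) / (((w : ℝ) - (u : ℝ) : ℝ) : EReal)

/-- The breaks of `NP_ρ(ℓ)`: the integers `-n` and `0`, and the integers `-n < m < 0` such that the
slope on `[m-1, m]` is strictly smaller than the slope on `[m, m+1]`. -/
def newtonBreaks (ρ : ℝ) (ℓ : TwistedPolynomial (ddx k)) : Set ℤ :=
  {m | m = -(ℓ.natDegree : ℤ) ∨ m = 0 ∨ (-(ℓ.natDegree : ℤ) < m ∧ m < 0 ∧
    newtonSlope ρ ℓ (m - 1) m < newtonSlope ρ ℓ m (m + 1))}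

/-- The slope of `NP_ρ(ℓ)` on `[u, w]` is effective if it is smaller than
`-log |d/dx|_{F_ρ} = log ρ`. -/
def IsEffective (ρ : ℝ) (ℓ : TwistedPolynomial (ddx k)) (u w : ℤ) : Prop :=
  newtonSlope ρ ℓ u w < (Real.log ρ : EReal)

/-- The real number `c` is small enough for `ℓ = ∑ aᵢ Tⁱ`, of degree `n` with coefficients in
`A_{γ,x}`. Here `bᵢ` is the lowest coefficient of the Laurent series `aᵢ`; the conditions involve
only those indices for which `aᵢ ≠ 0`, since `bᵢ` makes sense only for these. -/
structure IsSmallRadius (γ : ℝ) (ℓ : TwistedPolynomial (ddx k)) (c : ℝ) : Prop where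
  pos : 0 < c
  le : c ≤ γ
  lt_one : c < 1
  gaussNorm_eq : ∀ ρ : ℝ, 0 < ρ → ρ ≤ c → ∀ i ≤ ℓ.natDegree, ℓ.coeff i ≠ 0 →
    gaussNorm ρ (ℓ.coeff i) = ‖(ℓ.coeff i).leadingCoeff‖ * ρ ^ (ℓ.coeff i).order
  triple : ∀ ρ : ℝ, 0 < ρ → ρ ≤ c → ∀ h i j : ℕ, h < i → i ≤ j → j ≤ ℓ.natDegree →
    ℓ.coeff h ≠ 0 → ℓ.coeff i ≠ 0 → ℓ.coeff j ≠ 0 →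
    |Real.log
        ((‖(ℓ.coeff i).leadingCoeff‖ / ‖(ℓ.coeff h).leadingCoeff‖) ^ (1 / ((i : ℝ) - (h : ℝ))) *
          (‖(ℓ.coeff h).leadingCoeff‖ / ‖(ℓ.coeff j).leadingCoeff‖) ^ (1 / ((j : ℝ) - (h : ℝ)))) /
      (-Real.log ρ)| < 1 / ((ℓ.natDegree : ℝ) ^ 2 + 1)
  pair : ∀ ρ : ℝ, 0 < ρ → ρ ≤ c → ∀ i j : ℕ, i < j → j ≤ ℓ.natDegree →
    ℓ.coeff i ≠ 0 → ℓ.coeff j ≠ 0 →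
    |Real.log
        ((‖(ℓ.coeff j).leadingCoeff‖ / ‖(ℓ.coeff i).leadingCoeff‖) ^ (1 / ((j : ℝ) - (i : ℝ)))) /
      (-Real.log ρ)| < 1 / ((ℓ.natDegree : ℝ) + 1)

end Analytic

end DiffMod

end

open DiffMod

/-
Base change to a ramified extension over which the differential module becomes triangular turns `ℓ`
into a product of factors `T - gⱼ`, one for each formal slope `βⱼ = max 0 (-1 - ord gⱼ)`.
Multiplication by `T - g` multiplies the Gauss norm of radius `R` in `T` by `max R |g|` as soon as
`R` exceeds the operator norm of the derivation. Hence, for `r > 1`, the maximum over `i` of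
`r i - ord aᵢ` equals `∑ⱼ max r (1 + βⱼ)`: the formal slopes are read off the supporting lines of
the points `(-i, ord aᵢ)`.

For small `ρ` the point `(-i, v_ρ(aᵢ))` lies at height `(-log ρ) ord aᵢ - log |bᵢ|`. Whether three
such points make a convex turn is decided by an integral determinant in their orders, up to a
perturbation smaller than `-log ρ` by condition (ii). If that integer is nonzero, it determines the
sign; if it is zero, the sign is that of a quantity independent of `ρ`. So the breaks do not depend
on `ρ`, and an edge of `NP_c` is also an edge for the orders.
-/

noncomputable section

namespace DiffMod

open Polynomial

section TwistedLinearFactor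

variable {A : Type*} [CommRing A] (d : AddDerivation A)

theorem coeff_dCoeff (p : A[X]) (i : ℕ) :
    (TwistedPolynomial.dCoeff d p).coeff i = d (p.coeff i) := by
  induction p using Polynomial.induction_on' with
  | add p q hp hq => simp [hp, hq]
  | monomial j a =>
    rw [TwistedPolynomial.dCoeff_monomial, coeff_monomial, coeff_monomial]
    split <;> simp

theorem degree_dCoeff_le (p : A[X]) : (TwistedPolynomial.dCoeff d p).degree ≤ p.degree := by
  refine degree_mono fun i hi => ?_
  rw [mem_support_iff, coeff_dCoeff] at hi
  exact mem_support_iff.mpr fun h => hi (by rw [h, map_zero])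

/-- The product `(T - g) p` of twisted polynomials. -/
def mulLinear (g : A) (p : A[X]) : A[X] := TwistedPolynomial.mulT d p - g • p

theorem mulLinear_eq (g : A) (p : A[X]) :
    mulLinear d g p = (X - C g) * p + TwistedPolynomial.dCoeff d p := by
  have hT : TwistedPolynomial.mulT d p = X * p + TwistedPolynomial.dCoeff d p := rfl
  rw [mulLinear, hT, smul_eq_C_mul]
  ring

theorem degree_dCoeff_lt [Nontrivial A] {p : A[X]} (hp : p.Monic) (g : A) :
    (TwistedPolynomial.dCoeff d p).degree < ((X - C g) * p).degree := by
  rw [hp.degree_mul, degree_X_sub_C, degree_eq_natDegree hp.ne_zero]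
  refine (degree_dCoeff_le d p).trans_lt ?_
  rw [degree_eq_natDegree hp.ne_zero]
  exact_mod_cast lt_one_add p.natDegree

theorem monic_mulLinear [Nontrivial A] (g : A) {p : A[X]} (hp : p.Monic) :
    (mulLinear d g p).Monic := by
  rw [mulLinear_eq]
  exact ((monic_X_sub_C g).mul hp).add_of_left (degree_dCoeff_lt d hp g)

theorem natDegree_mulLinear [Nontrivial A] (g : A) {p : A[X]} (hp : p.Monic) :
    (mulLinear d g p).natDegree = p.natDegree + 1 := by
  rw [mulLinear_eq, natDegree_add_eq_left_of_degree_lt (degree_dCoeff_lt d hp g),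
    (monic_X_sub_C g).natDegree_mul hp, natDegree_X_sub_C, add_comm]

variable {d} {v : AbsoluteValue A ℝ} {E R : ℝ}

theorem nonneg_of_abv_deriv_le [Nontrivial A] (hE : ∀ a, v (d a) ≤ E * v a) : 0 ≤ E := by
  have h1 := hE 1
  rw [d.apply_one, map_zero v] at h1
  exact nonneg_of_mul_nonneg_left h1 (v.pos one_ne_zero)

theorem gaussNorm_dCoeff_le [Nontrivial A] (hE : ∀ a, v (d a) ≤ E * v a) (hR : 0 ≤ R) (p : A[X]) :
    (TwistedPolynomial.dCoeff d p).gaussNorm v R ≤ E * p.gaussNorm v R := by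
  obtain ⟨i, hi⟩ := exists_eq_gaussNorm v R (TwistedPolynomial.dCoeff d p)
  have hE₀ := nonneg_of_abv_deriv_le hE
  calc (TwistedPolynomial.dCoeff d p).gaussNorm v R
      = v (d (p.coeff i)) * R ^ i := by rw [hi, coeff_dCoeff]
    _ ≤ E * v (p.coeff i) * R ^ i := by gcongr; exact hE _
    _ = E * (v (p.coeff i) * R ^ i) := mul_assoc ..
    _ ≤ E * p.gaussNorm v R := by gcongr; exact le_gaussNorm v p hR i

theorem gaussNorm_X_sub_C [IsDomain A] (hv : IsNonarchimedean v) (hR : 0 ≤ R) (g : A) :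
    (X - C g).gaussNorm v R = max R (v g) := by
  refine le_antisymm ?_ (max_le ?_ ?_)
  · have hX : (X : A[X]).gaussNorm v R = R := by
      rw [← monomial_one_one_eq_X, gaussNorm_monomial, map_one v, one_mul, pow_one]
    calc (X - C g).gaussNorm v R = (X + C (-g)).gaussNorm v R := by rw [C_neg, sub_eq_add_neg]
      _ ≤ max ((X : A[X]).gaussNorm v R) ((C (-g)).gaussNorm v R) :=
        isNonarchimedean_gaussNorm v hv hR _ _
      _ = max R (v g) := by rw [hX, gaussNorm_C, v.map_neg]
  · have h1 := le_gaussNorm v (X - C g) hR 1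
    rwa [coeff_sub, coeff_X_one, coeff_C_succ, sub_zero, map_one v, one_mul, pow_one] at h1
  · have h0 := le_gaussNorm v (X - C g) hR 0
    rwa [coeff_sub, coeff_X_zero, coeff_C_zero, zero_sub, v.map_neg, pow_zero, mul_one] at h0

/-- The radius `R` exceeds the operator norm of the derivation, so `(T - g) p` differs from the
product of commuting polynomials by a term of smaller norm. -/
theorem gaussNorm_mulLinear [IsDomain A] (hv : IsNonarchimedean v)
    (hE : ∀ a, v (d a) ≤ E * v a) (hR : E < R) (g : A) {p : A[X]} (hp : p ≠ 0) :
    (mulLinear d g p).gaussNorm v R = max R (v g) * p.gaussNorm v R := by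
  have hR₀ : 0 < R := (nonneg_of_abv_deriv_le hE).trans_lt hR
  have := gaussNorm_isAbsoluteValue hv hR₀
  have hp₀ : 0 < p.gaussNorm v R := (IsAbsoluteValue.abv_pos (Polynomial.gaussNorm v R)).mpr hp
  have hlinear : ((X - C g) * p).gaussNorm v R = max R (v g) * p.gaussNorm v R := by
    rw [gaussNorm_mul hv hR₀, gaussNorm_X_sub_C hv hR₀.le]
  have hsmall : (TwistedPolynomial.dCoeff d p).gaussNorm v R < ((X - C g) * p).gaussNorm v R :=
    calc (TwistedPolynomial.dCoeff d p).gaussNorm v R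
        ≤ E * p.gaussNorm v R := gaussNorm_dCoeff_le hE hR₀.le p
      _ < max R (v g) * p.gaussNorm v R := by gcongr; exact hR.trans_le (le_max_left ..)
      _ = ((X - C g) * p).gaussNorm v R := hlinear.symm
  have hna : IsNonarchimedean (IsAbsoluteValue.toAbsoluteValue (Polynomial.gaussNorm v R)) :=
    isNonarchimedean_gaussNorm v hv hR₀.le
  rw [mulLinear_eq, ← hlinear]
  exact (hna.add_eq_max_of_ne hsmall.ne').trans (max_eq_left hsmall.le)

end TwistedLinearFactor

section Evaluation

variable {A M : Type*} [CommRing A] {d : AddDerivation A} [AddCommGroup M] [Module A M]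
  (D : DifferentialOperator d M)

theorem DifferentialOperator.toFun_add (x y : M) : D.toFun (x + y) = D.toFun x + D.toFun y :=
  D.map_add' x y

theorem DifferentialOperator.toFun_zero : D.toFun 0 = 0 := D.map_zero'

/-- The action `∑ pᵢ Tⁱ ↦ ∑ pᵢ Dⁱ x` of twisted polynomials on the vector `x`. -/
def evalAt (x : M) : A[X] →ₗ[A] M :=
  Polynomial.lsum fun i => LinearMap.toSpanSingleton A M (D.toFun^[i] x)

theorem evalAt_monomial (x : M) (i : ℕ) (a : A) :
    evalAt D x (monomial i a) = a • D.toFun^[i] x := by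
  simp [evalAt, Polynomial.lsum_apply]

theorem evalAt_one (x : M) : evalAt D x 1 = x := by
  rw [← monomial_zero_one, evalAt_monomial, one_smul, Function.iterate_zero_apply]

theorem evalAt_mulT (x : M) (p : A[X]) :
    evalAt D x (TwistedPolynomial.mulT d p) = D.toFun (evalAt D x p) := by
  induction p using Polynomial.induction_on' with
  | add p q hp hq => rw [map_add, map_add, map_add, D.toFun_add, hp, hq]
  | monomial i a =>
    rw [TwistedPolynomial.mulT_monomial, map_add, evalAt_monomial, evalAt_monomial,
      evalAt_monomial, D.leibniz, Function.iterate_succ_apply']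

theorem evalAt_mulLinear (x : M) (g : A) (p : A[X]) :
    evalAt D x (mulLinear d g p) = D.toFun (evalAt D x p) - g • evalAt D x p := by
  rw [mulLinear, map_sub, evalAt_mulT, map_smul]

variable {D} {r : ℕ} {e : Module.Basis (Fin r) A M} {f : Fin r → A}

theorem toFun_mem_flag (hf : ∀ i, D.toFun (e i) - f i • e i ∈ e.flag i.castSucc)
    (j : Fin (r + 1)) {y : M} (hy : y ∈ e.flag j) : D.toFun y ∈ e.flag j := by
  induction hy using Submodule.span_induction with
  | mem y hy =>
    obtain ⟨i, hi, rfl⟩ := hy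
    have hdiag : f i • e i ∈ e.flag j := Submodule.smul_mem _ _ (e.self_mem_flag hi)
    simpa using add_mem (e.flag_mono (le_of_lt hi) (hf i)) hdiag
  | zero => rw [D.toFun_zero]; exact zero_mem _
  | add y z _ _ hy hz => rw [D.toFun_add]; exact add_mem hy hz
  | smul a y hy hDy =>
    rw [D.leibniz]
    exact add_mem (Submodule.smul_mem _ _ hDy) (Submodule.smul_mem _ _ hy)

end Evaluation

section TriangularBasis

variable {K V : Type*} [Field K] {d : AddDerivation K} [AddCommGroup V] [Module K V]
  {D : DifferentialOperator d V} {r : ℕ} {e : Module.Basis (Fin r) K V} {f : Fin r → K}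
  {v : AbsoluteValue K ℝ} {E : ℝ}

theorem exists_sub_smul_mem_flag (hE : ∀ a, v (d a) ≤ E * v a)
    (hf : ∀ i, D.toFun (e i) - f i • e i ∈ e.flag i.castSucc) (j : Fin r) {y : V}
    (hy : y ∈ e.flag j.succ) :
    ∃ g, D.toFun y - g • y ∈ e.flag j.castSucc ∧ v (g - f j) ≤ E := by
  rw [e.flag_succ, Submodule.mem_sup] at hy
  obtain ⟨_, hy, w, hw, rfl⟩ := hy
  obtain ⟨u, rfl⟩ := Submodule.mem_span_singleton.mp hy
  rcases eq_or_ne u 0 with rfl | hu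
  · refine ⟨f j, ?_, by simpa using nonneg_of_abv_deriv_le hE⟩
    rw [zero_smul, zero_add]
    exact sub_mem (toFun_mem_flag hf _ hw) (Submodule.smul_mem _ _ hw)
  · refine ⟨f j + u⁻¹ * d u, ?_, ?_⟩
    · have hsplit : D.toFun (u • e j + w) - (f j + u⁻¹ * d u) • (u • e j + w) =
          u • (D.toFun (e j) - f j • e j) + D.toFun w - (f j + u⁻¹ * d u) • w := by
        have hgu : (f j + u⁻¹ * d u) * u = u * f j + d u := by field_simp
        rw [D.toFun_add, D.leibniz, smul_add, smul_smul, hgu, add_smul, smul_sub, smul_smul]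
        abel
      rw [hsplit]
      exact sub_mem (add_mem (Submodule.smul_mem _ _ (hf j)) (toFun_mem_flag hf _ hw))
        (Submodule.smul_mem _ _ hw)
    · rw [add_sub_cancel_left, map_mul, map_inv₀, inv_mul_le_iff₀ (v.pos hu), mul_comm]
      exact hE u

theorem max_abv_eq_of_abv_sub_le {A : Type*} [CommRing A] {v : AbsoluteValue A ℝ}
    (hv : IsNonarchimedean v) {R : ℝ} {a b : A} (h : v (a - b) ≤ R) :
    max R (v a) = max R (v b) := by
  have hle : ∀ {a b : A}, v (a - b) ≤ R → max R (v a) ≤ max R (v b) := fun {a b} h =>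
    max_le (le_max_left _ _) <| calc
      v a = v (a - b + b) := by rw [sub_add_cancel]
      _ ≤ max (v (a - b)) (v b) := hv _ _
      _ ≤ max R (v b) := max_le_max_right _ h
  exact le_antisymm (hle h) (hle (by rwa [v.map_sub]))

/-- The cyclic vector `x` is pushed down the flag by one linear factor at a time. -/
theorem exists_monic_evalAt_eq_zero (hv : IsNonarchimedean v) (hE : ∀ a, v (d a) ≤ E * v a)
    (hf : ∀ i, D.toFun (e i) - f i • e i ∈ e.flag i.castSucc) (x : V) :
    ∃ P : K[X], P.Monic ∧ P.natDegree = r ∧ evalAt D x P = 0 ∧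
      ∀ R, E < R → P.gaussNorm v R = ∏ i, max R (v (f i)) := by
  suffices h : ∀ j : Fin (r + 1), ∃ P : K[X], P.Monic ∧ P.natDegree + j = r ∧
      evalAt D x P ∈ e.flag j ∧ ∀ R, E < R →
        P.gaussNorm v R = ∏ i with j ≤ Fin.castSucc i, max R (v (f i)) by
    simpa using h 0
  intro j
  induction j using Fin.reverseInduction with
  | last =>
    refine ⟨1, monic_one, by simp, by simp, fun R _ => ?_⟩
    rw [← monomial_zero_one, gaussNorm_monomial, map_one, one_mul, pow_zero]
    simp [Fin.last_le_iff, (Fin.castSucc_lt_last _).ne]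
  | cast j ih =>
    obtain ⟨P, hP, hdeg, hmem, hnorm⟩ := ih
    obtain ⟨g, hg, hgf⟩ := exists_sub_smul_mem_flag hE hf j hmem
    refine ⟨mulLinear d g P, monic_mulLinear d g hP, ?_, ?_, fun R hR => ?_⟩
    · rw [natDegree_mulLinear d g hP, add_assoc, add_comm 1]
      exact hdeg
    · rwa [evalAt_mulLinear]
    · have hinsert : Finset.univ.filter (j.castSucc ≤ Fin.castSucc ·) =
          insert j (Finset.univ.filter (j.succ ≤ Fin.castSucc ·)) := by
        ext i
        simp only [Finset.mem_filter, Finset.mem_univ, true_and, Finset.mem_insert, Fin.le_def,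
          Fin.ext_iff, Fin.val_castSucc, Fin.val_succ]
        omega
      rw [gaussNorm_mulLinear hv hE hR g hP.ne_zero, hnorm R hR, hinsert,
        Finset.prod_insert (by simp),
        max_abv_eq_of_abv_sub_le hv (hgf.trans hR.le)]

end TriangularBasis

section AnnihilatedVector

variable {A M : Type*} [CommRing A] {d : AddDerivation A} [AddCommGroup M] [Module A M]
  {D : DifferentialOperator d M} {x : M} {P : A[X]}

theorem degree_mulT_le (q : A[X]) : (TwistedPolynomial.mulT d q).degree ≤ q.degree + 1 := by
  have hX : (X * q).degree ≤ q.degree + 1 := by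
    rw [X_mul]
    exact (degree_mul_le q X).trans (add_le_add le_rfl degree_X_le)
  have hd : (TwistedPolynomial.dCoeff d q).degree ≤ q.degree + 1 :=
    (degree_dCoeff_le d q).trans (le_add_of_nonneg_right zero_le_one)
  exact (degree_add_le _ _).trans (max_le hX hd)

theorem evalAt_mem_map_degreeLT (hP : P.Monic) (hP₀ : evalAt D x P = 0) {q : A[X]}
    (hq : q.degree ≤ P.natDegree) :
    evalAt D x q ∈ (degreeLT A P.natDegree).map (evalAt D x) := by
  refine ⟨q - q.coeff P.natDegree • P, ?_, by rw [map_sub, map_smul, hP₀, smul_zero, sub_zero]⟩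
  rw [SetLike.mem_coe, mem_degreeLT, degree_lt_iff_coeff_zero]
  intro i hi
  rw [coeff_sub, coeff_smul, smul_eq_mul]
  rcases hi.eq_or_lt with rfl | hi
  · rw [hP.coeff_natDegree, mul_one, sub_self]
  · rw [coeff_eq_zero_of_degree_lt (hq.trans_lt (by exact_mod_cast hi)),
      coeff_eq_zero_of_natDegree_lt hi, mul_zero, sub_zero]

theorem map_degreeLT_eq_top (hx : Function.Surjective (evalAt D x)) (hP : P.Monic)
    (hP₀ : evalAt D x P = 0) : (degreeLT A P.natDegree).map (evalAt D x) = ⊤ := by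
  set W := (degreeLT A P.natDegree).map (evalAt D x)
  have hstable : ∀ y ∈ W, D.toFun y ∈ W := by
    rintro _ ⟨q, hq, rfl⟩
    rw [← evalAt_mulT]
    exact evalAt_mem_map_degreeLT hP hP₀
      ((degree_mulT_le q).trans (Nat.WithBot.add_one_le_of_lt (mem_degreeLT.mp hq)))
  have hiter : ∀ i, D.toFun^[i] x ∈ W := fun i => by
    induction i with
    | zero =>
      have h1 := evalAt_mem_map_degreeLT hP hP₀ (q := 1)
        (degree_one_le.trans (by exact_mod_cast Nat.zero_le _))
      rwa [evalAt_one] at h1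
    | succ i ih => rw [Function.iterate_succ_apply']; exact hstable _ ih
  rw [eq_top_iff]
  rintro y -
  obtain ⟨q, rfl⟩ := hx y
  rw [evalAt, Polynomial.lsum_apply]
  exact Submodule.sum_mem _ fun i _ => Submodule.smul_mem _ _ (hiter i)

end AnnihilatedVector

section CyclicVector

variable {K V : Type*} [Field K] {d : AddDerivation K} [AddCommGroup V] [Module K V]
  {D : DifferentialOperator d V} {x : V} {P Q : K[X]}

theorem finrank_le_of_evalAt_eq_zero (hx : Function.Surjective (evalAt D x)) (hP : P.Monic)
    (hP₀ : evalAt D x P = 0) : Module.finrank K V ≤ P.natDegree := by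
  have e := degreeLTEquiv K P.natDegree
  have : Module.Finite K (degreeLT K P.natDegree) := Module.Finite.equiv e.symm
  calc Module.finrank K V = Module.finrank K ((degreeLT K P.natDegree).map (evalAt D x)) := by
        rw [map_degreeLT_eq_top hx hP hP₀, finrank_top]
    _ ≤ Module.finrank K (degreeLT K P.natDegree) := Submodule.finrank_map_le _ _
    _ = P.natDegree := by rw [e.finrank_eq, Module.finrank_fin_fun]

theorem eq_of_evalAt_eq_zero (hx : Function.Surjective (evalAt D x))
    (hP : P.Monic) (hQ : Q.Monic) (hP₀ : evalAt D x P = 0) (hQ₀ : evalAt D x Q = 0)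
    (hPd : P.natDegree = Module.finrank K V) (hQd : Q.natDegree = Module.finrank K V) :
    P = Q := by
  by_contra hne
  have hsub : P - Q ≠ 0 := sub_ne_zero.mpr hne
  have hlt : (P - Q).degree < P.degree := by
    refine degree_sub_lt_left ?_ hP.ne_zero (by rw [hP.leadingCoeff, hQ.leadingCoeff])
    rw [degree_eq_natDegree hP.ne_zero, degree_eq_natDegree hQ.ne_zero, hPd, hQd]
  have hfin := finrank_le_of_evalAt_eq_zero hx (monic_mul_leadingCoeff_inv hsub) (by
    rw [mul_comm, ← smul_eq_C_mul, map_smul, map_sub, hP₀, hQ₀, sub_zero, smul_zero])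
  rw [natDegree_mul_C (inv_ne_zero (leadingCoeff_ne_zero.mpr hsub)), ← hPd] at hfin
  exact (natDegree_lt_natDegree hsub hlt).not_ge hfin

end CyclicVector

namespace RamifiedField

variable (k : Type*) [Field k] (N : ℕ+)

theorem ord_mul {f g : RamifiedField k N} (hf : f ≠ 0) (hg : g ≠ 0) :
    ord k N (f * g) = ord k N f + ord k N g := by
  rw [ord, ord, ord, map_mul, HahnSeries.order_mul ((_root_.map_ne_zero _).mpr hf)
    ((_root_.map_ne_zero _).mpr hg), Int.cast_add, add_div]

theorem ord_le_ord_of_order_le {f g : RamifiedField k N}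
    (h : (toLaurent k N f).order ≤ (toLaurent k N g).order) : ord k N f ≤ ord k N g :=
  div_le_div_of_nonneg_right (by exact_mod_cast h) (by positivity)

theorem min_ord_le_ord_add {f g : RamifiedField k N} (hfg : f + g ≠ 0) :
    min (ord k N f) (ord k N g) ≤ ord k N (f + g) := by
  have h : min (toLaurent k N f).order (toLaurent k N g).order ≤ (toLaurent k N (f + g)).order := by
    rw [map_add]
    exact HahnSeries.min_order_le_order_add (by rwa [← map_add, _root_.map_ne_zero])
  exact (min_le_iff.mp h).elim (fun h => min_le_of_left_le (ord_le_ord_of_order_le k N h))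
    fun h => min_le_of_right_le (ord_le_ord_of_order_le k N h)

/-- The function `exp (-ord_x f)` on `k̄((x^{1/N}))`, with the value `0` at `f = 0`, where `ord` has
the junk value `0`. -/
def expNegOrd (f : RamifiedField k N) : ℝ :=
  open Classical in if f = 0 then 0 else Real.exp (-(ord k N f : ℝ))

theorem expNegOrd_zero : expNegOrd k N 0 = 0 := if_pos rfl

theorem expNegOrd_of_ne_zero {f : RamifiedField k N} (hf : f ≠ 0) :
    expNegOrd k N f = Real.exp (-(ord k N f : ℝ)) := if_neg hf

theorem expNegOrd_nonneg (f : RamifiedField k N) : 0 ≤ expNegOrd k N f := by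
  unfold expNegOrd
  split <;> positivity

theorem isNonarchimedean_expNegOrd : IsNonarchimedean (expNegOrd k N) := by
  intro f g
  rcases eq_or_ne (f + g) 0 with hfg | hfg
  · rw [hfg, expNegOrd_zero]
    exact le_max_of_le_left (expNegOrd_nonneg k N f)
  rcases eq_or_ne f 0 with rfl | hf
  · rw [zero_add]
    exact le_max_right _ _
  rcases eq_or_ne g 0 with rfl | hg
  · rw [add_zero]
    exact le_max_left _ _
  rw [expNegOrd_of_ne_zero k N hf, expNegOrd_of_ne_zero k N hg, expNegOrd_of_ne_zero k N hfg,
    ← Real.exp_monotone.map_max, Real.exp_le_exp, max_neg_neg, neg_le_neg_iff]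
  exact_mod_cast min_ord_le_ord_add k N hfg

/-- The absolute value of `k̄((x^{1/N}))` defined by the valuation `ord_x`, normalized such that
`|x| = exp (-1)`. -/
def abv : AbsoluteValue (RamifiedField k N) ℝ where
  toFun := expNegOrd k N
  map_mul' f g := by
    rcases eq_or_ne f 0 with rfl | hf
    · simp only [zero_mul, expNegOrd_zero]
    rcases eq_or_ne g 0 with rfl | hg
    · simp only [mul_zero, expNegOrd_zero]
    rw [expNegOrd_of_ne_zero k N hf, expNegOrd_of_ne_zero k N hg,
      expNegOrd_of_ne_zero k N (mul_ne_zero hf hg), ord_mul k N hf hg, ← Real.exp_add, Rat.cast_add,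
      neg_add]
  nonneg' := expNegOrd_nonneg k N
  eq_zero' f := ⟨fun h => by_contra fun hf => (Real.exp_pos _).ne' <|
    (expNegOrd_of_ne_zero k N hf).symm.trans h, fun h => h ▸ expNegOrd_zero k N⟩
  add_le' _ _ := (isNonarchimedean_expNegOrd k N).add_le (expNegOrd_nonneg k N)

theorem abv_of_ne_zero {f : RamifiedField k N} (hf : f ≠ 0) :
    abv k N f = Real.exp (-(ord k N f : ℝ)) := expNegOrd_of_ne_zero k N hf

theorem coeff_toLaurent_ddx (f : RamifiedField k N) (n : ℤ) :
    (toLaurent k N (ddx k N f)).coeff n =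
      ((N : ℕ) : AlgebraicClosure k)⁻¹ * (((n + (N : ℕ) : ℤ) : AlgebraicClosure k) *
        (toLaurent k N f).coeff (n + ((N : ℕ) : ℤ))) := by
  change (HahnSeries.single (1 - ((N : ℕ) : ℤ)) ((N : ℕ) : AlgebraicClosure k)⁻¹ *
    LaurentSeries.derivative (AlgebraicClosure k) (toLaurent k N f)).coeff n = _
  rw [show n = (n + (N : ℕ) - 1) + (1 - ((N : ℕ) : ℤ)) by ring, HahnSeries.coeff_single_mul_add]
  simp

theorem ord_le_ord_ddx_add_one {f : RamifiedField k N} (hf : ddx k N f ≠ 0) :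
    ord k N f ≤ ord k N (ddx k N f) + 1 := by
  have hN : (0 : ℚ) < ((N : ℕ) : ℚ) := by exact_mod_cast N.pos
  have hle : (toLaurent k N f).order ≤ (toLaurent k N (ddx k N f)).order + ((N : ℕ) : ℤ) := by
    refine HahnSeries.order_le_of_coeff_ne_zero fun hz => ?_
    apply HahnSeries.coeff_order_eq_zero.not.mpr ((_root_.map_ne_zero (toLaurent k N)).mpr hf)
    rw [coeff_toLaurent_ddx, hz, mul_zero, mul_zero]
  rw [ord, ord, ← div_self hN.ne', ← add_div]
  exact div_le_div_of_nonneg_right (by exact_mod_cast hle) hN.le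

theorem abv_ddx_le (f : RamifiedField k N) : abv k N (ddx k N f) ≤ Real.exp 1 * abv k N f := by
  rcases eq_or_ne (ddx k N f) 0 with h₀ | h₀
  · rw [h₀, map_zero]
    exact mul_nonneg (Real.exp_pos _).le ((abv k N).nonneg f)
  have hf : f ≠ 0 := by
    rintro rfl
    exact h₀ (map_zero _)
  have hord : (ord k N f : ℝ) ≤ (ord k N (ddx k N f) : ℝ) + 1 := by
    exact_mod_cast ord_le_ord_ddx_add_one k N h₀
  rw [abv_of_ne_zero k N h₀, abv_of_ne_zero k N hf, ← Real.exp_add, Real.exp_le_exp]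
  linarith

theorem coeff_toLaurent_algebraMap (g : LaurentSeries k) (i : ℤ) :
    (toLaurent k N (algebraMap (LaurentSeries k) (RamifiedField k N) g)).coeff
      (((N : ℕ) : ℤ) * i) = algebraMap k (AlgebraicClosure k) (g.coeff i) :=
  HahnSeries.embDomain_coeff (a := i)

theorem order_toLaurent_algebraMap {g : LaurentSeries k} (hg : g ≠ 0) :
    (toLaurent k N (algebraMap (LaurentSeries k) (RamifiedField k N) g)).order =
      ((N : ℕ) : ℤ) * g.order := by
  apply le_antisymm
  · apply HahnSeries.order_le_of_coeff_ne_zero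
    rw [coeff_toLaurent_algebraMap]
    simpa using HahnSeries.coeff_order_eq_zero.not.mpr hg
  · rw [HahnSeries.le_order_iff_forall (by simpa using hg)]
    intro j hj
    by_cases hd : ((N : ℕ) : ℤ) ∣ j
    · obtain ⟨i, rfl⟩ := hd
      rw [coeff_toLaurent_algebraMap, HahnSeries.coeff_eq_zero_of_lt_order, map_zero]
      exact lt_of_mul_lt_mul_left hj (by positivity)
    · refine HahnSeries.embDomain_of_notMem_range ?_
      rintro ⟨i, rfl⟩
      exact hd ⟨i, rfl⟩

theorem abv_algebraMap {g : LaurentSeries k} (hg : g ≠ 0) :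
    abv k N (algebraMap (LaurentSeries k) (RamifiedField k N) g) =
      Real.exp (-(g.order : ℝ)) := by
  have hord : ord k N (algebraMap (LaurentSeries k) (RamifiedField k N) g) = g.order := by
    rw [ord, order_toLaurent_algebraMap k N hg]
    push_cast
    field_simp
  rw [abv_of_ne_zero k N (by simpa using hg), hord, Rat.cast_intCast]

theorem max_exp_abv {r : ℝ} (hr : 1 ≤ r) (f : RamifiedField k N) :
    max (Real.exp r) (abv k N f) = Real.exp (max r (1 + (rankOneSlope k N f : ℝ))) := by
  rcases eq_or_ne f 0 with rfl | hf
  · have hslope : rankOneSlope k N 0 = 0 := by simp [rankOneSlope, ord]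
    rw [map_zero, max_eq_left (Real.exp_pos r).le, hslope, Rat.cast_zero, add_zero, max_eq_left hr]
  · have hslope : (1 : ℝ) + (rankOneSlope k N f : ℝ) = max 1 (-(ord k N f : ℝ)) := by
      rw [rankOneSlope, Rat.cast_max, ← max_add_add_left]
      push_cast
      ring_nf
    rw [abv_of_ne_zero k N hf, ← Real.exp_monotone.map_max, hslope, ← max_assoc, max_eq_left hr]

theorem isGreatest_of_gaussNorm_map_eq_exp {p : (LaurentSeries k)[X]} {r y : ℝ}
    (h : (p.map (algebraMap (LaurentSeries k) (RamifiedField k N))).gaussNorm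
      (abv k N) (Real.exp r) = Real.exp y) :
    IsGreatest ((fun i : ℕ => r * i - (p.coeff i).order) '' {i | p.coeff i ≠ 0}) y := by
  have hterm : ∀ i, p.coeff i ≠ 0 →
      abv k N ((p.map (algebraMap _ (RamifiedField k N))).coeff i) * Real.exp r ^ i =
        Real.exp (r * i - (p.coeff i).order) := fun i hi => by
    rw [coeff_map, abv_algebraMap k N hi, ← Real.exp_nat_mul, ← Real.exp_add]
    ring_nf
  constructor
  · obtain ⟨i, hi⟩ := exists_eq_gaussNorm (abv k N) (Real.exp r)
      (p.map (algebraMap _ (RamifiedField k N)))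
    rw [h] at hi
    have hi₀ : p.coeff i ≠ 0 := fun h₀ => (Real.exp_pos y).ne' <| by
      rw [hi, coeff_map, h₀, map_zero, map_zero, zero_mul]
    rw [hterm i hi₀, Real.exp_eq_exp] at hi
    exact ⟨i, hi₀, hi.symm⟩
  · rintro _ ⟨i, hi, rfl⟩
    rw [← Real.exp_le_exp, ← hterm i hi, ← h]
    exact le_gaussNorm _ _ (Real.exp_pos r).le i

end RamifiedField

section CyclicModule

theorem TwistedPolynomial.toPoly_T_mul {R : Type*} [CommRing R] (d : AddDerivation R)
    (p : TwistedPolynomial d) : toPoly d (T d * p) = mulT d (toPoly d p) := by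
  have hX : mulEnd d X = mulT d := by
    rw [← monomial_one_one_eq_X, mulEnd_monomial, map_one, one_mul, pow_one]
  exact DFunLike.congr_fun hX p

theorem TwistedPolynomial.toPoly_T_pow {R : Type*} [CommRing R] (d : AddDerivation R) (i : ℕ) :
    toPoly d (T d ^ i) = X ^ i := by
  induction i with
  | zero => rfl
  | succ i ih =>
    rw [pow_succ', toPoly_T_mul, ih, X_pow_eq_monomial, X_pow_eq_monomial, mulT_monomial,
      d.apply_one, monomial_zero_right, add_zero]

theorem TwistedPolynomial.toPoly_symm_monomial {R : Type*} [CommRing R] (d : AddDerivation R)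
    (i : ℕ) (a : R) : (toPoly d).symm (monomial i a) = a • T d ^ i := by
  rw [LinearEquiv.symm_apply_eq, map_smul, toPoly_T_pow, X_pow_eq_monomial, smul_monomial,
    smul_eq_mul, mul_one]

variable {k : Type*} [Field k] [CharZero k] (N : ℕ+) (ℓ : TwistedPolynomial (ddx k))

/-- The base change of the differential module `k((x)){T} / k((x)){T}ℓ` to `k̄((x^{1/N}))`. -/
abbrev ramifiedOperator : DifferentialOperator (RamifiedField.ddx k N)
    (RamifiedField k N ⊗[LaurentSeries k] CyclicModule ℓ) :=
  (cyclicOperator ℓ).baseChange (RamifiedField.ddx k N) (RamifiedField.ddx_algebraMap k N)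

/-- The cyclic vector `1 ⊗ 1` of the base change of `k((x)){T} / k((x)){T}ℓ`. -/
abbrev cyclicVector : RamifiedField k N ⊗[LaurentSeries k] CyclicModule ℓ :=
  1 ⊗ₜ Submodule.Quotient.mk 1

theorem ramifiedOperator_tmul (b : RamifiedField k N) (m : CyclicModule ℓ) :
    (ramifiedOperator N ℓ).toFun (b ⊗ₜ m) =
      RamifiedField.ddx k N b ⊗ₜ m + b ⊗ₜ (TwistedPolynomial.T (ddx k) • m) := rfl

theorem iterate_ramifiedOperator (i : ℕ) :
    (ramifiedOperator N ℓ).toFun^[i] (cyclicVector N ℓ) =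
      1 ⊗ₜ Submodule.Quotient.mk (TwistedPolynomial.T (ddx k) ^ i) := by
  induction i with
  | zero => rfl
  | succ i ih =>
    rw [Function.iterate_succ_apply', ih, ramifiedOperator_tmul, AddDerivation.apply_one,
      TensorProduct.zero_tmul, zero_add, ← Submodule.Quotient.mk_smul, smul_eq_mul, pow_succ']

theorem evalAt_cyclicVector_map (p : (LaurentSeries k)[X]) :
    evalAt (ramifiedOperator N ℓ) (cyclicVector N ℓ)
        (p.map (algebraMap (LaurentSeries k) (RamifiedField k N))) =
      1 ⊗ₜ Submodule.Quotient.mk ((TwistedPolynomial.toPoly (ddx k)).symm p) := by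
  induction p using Polynomial.induction_on' with
  | add p q hp hq =>
    rw [Polynomial.map_add, map_add, hp, hq, map_add, Submodule.Quotient.mk_add,
      TensorProduct.tmul_add]
  | monomial i a =>
    rw [map_monomial, evalAt_monomial, iterate_ramifiedOperator,
      TwistedPolynomial.toPoly_symm_monomial, Submodule.Quotient.mk_smul,
      TensorProduct.tmul_smul, algebraMap_smul]

theorem evalAt_cyclicVector_surjective :
    Function.Surjective (evalAt (ramifiedOperator N ℓ) (cyclicVector N ℓ)) := by
  rw [← LinearMap.range_eq_top, eq_top_iff]
  rintro z -
  induction z using TensorProduct.induction_on with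
  | zero => exact zero_mem _
  | add y z hy hz => exact add_mem hy hz
  | tmul b m =>
    obtain ⟨p, rfl⟩ := Submodule.Quotient.mk_surjective _ m
    have hb : b ⊗ₜ[LaurentSeries k] (Submodule.Quotient.mk p : CyclicModule ℓ) =
        b • ((1 : RamifiedField k N) ⊗ₜ[LaurentSeries k] Submodule.Quotient.mk p) := by
      rw [TensorProduct.smul_tmul', smul_eq_mul, mul_one]
    rw [hb]
    exact Submodule.smul_mem _ _
      ⟨_, evalAt_cyclicVector_map N ℓ (TwistedPolynomial.toPoly (ddx k) p)⟩

variable {ℓ}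

theorem eq_map_toPoly_of_evalAt_eq_zero (hmonic : ℓ.Monic)
    (hrank : ℓ.natDegree = Module.finrank (RamifiedField k N)
      (RamifiedField k N ⊗[LaurentSeries k] CyclicModule ℓ))
    {P : (RamifiedField k N)[X]} (hP : P.Monic) (hdeg : P.natDegree = ℓ.natDegree)
    (hP₀ : evalAt (ramifiedOperator N ℓ) (cyclicVector N ℓ) P = 0) :
    P = (TwistedPolynomial.toPoly (ddx k) ℓ).map
      (algebraMap (LaurentSeries k) (RamifiedField k N)) := by
  refine eq_of_evalAt_eq_zero (evalAt_cyclicVector_surjective N ℓ) hP (hmonic.map _) hP₀ ?_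
    (hdeg.trans hrank) (by rwa [natDegree_map])
  rw [evalAt_cyclicVector_map, LinearEquiv.symm_apply_apply,
    (Submodule.Quotient.mk_eq_zero _).mpr (Submodule.mem_span_singleton_self ℓ),
    TensorProduct.tmul_zero]

theorem IsFormalSlopes.exists_gaussNorm_map_eq {s : Multiset ℚ}
    (hs : IsFormalSlopes (cyclicOperator ℓ) s) (hmonic : ℓ.Monic) (hcard : s.card = ℓ.natDegree) :
    ∃ N : ℕ+, ∀ r : ℝ, 1 < r →
      ((TwistedPolynomial.toPoly (ddx k) ℓ).map
          (algebraMap (LaurentSeries k) (RamifiedField k N))).gaussNorm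
        (RamifiedField.abv k N) (Real.exp r) =
      Real.exp (s.map fun β : ℚ => max r (1 + (β : ℝ))).sum := by
  obtain ⟨N, n, e, f, hf, rfl⟩ := hs
  obtain ⟨P, hP, hdeg, hP₀, hnorm⟩ := exists_monic_evalAt_eq_zero
    (RamifiedField.isNonarchimedean_expNegOrd k N) (RamifiedField.abv_ddx_le k N) hf
    (cyclicVector N ℓ)
  have hn : ℓ.natDegree = n := by simpa using hcard.symm
  have hrank := hn.trans ((Module.finrank_eq_card_basis e).trans (Fintype.card_fin n)).symm
  refine ⟨N, fun r hr => ?_⟩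
  rw [← eq_map_toPoly_of_evalAt_eq_zero N hmonic hrank hP (hdeg.trans hn.symm) hP₀,
    hnorm _ (Real.exp_lt_exp.mpr hr), Multiset.map_map]
  calc ∏ i, max (Real.exp r) (RamifiedField.abv k N (f i))
      = ∏ i, Real.exp (max r (1 + (rankOneSlope k N (f i) : ℝ))) :=
        Finset.prod_congr rfl fun i _ => RamifiedField.max_exp_abv k N hr.le (f i)
    _ = Real.exp (∑ i, max r (1 + (rankOneSlope k N (f i) : ℝ))) := (Real.exp_sum _ _).symm

theorem IsFormalSlopes.isGreatest {s : Multiset ℚ} (hs : IsFormalSlopes (cyclicOperator ℓ) s)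
    (hmonic : ℓ.Monic) (hcard : s.card = ℓ.natDegree) {r : ℝ} (hr : 1 < r) :
    IsGreatest ((fun i : ℕ => r * i - (ℓ.coeff i).order) '' {i | ℓ.coeff i ≠ 0})
      (s.map fun β : ℚ => max r (1 + (β : ℝ))).sum := by
  obtain ⟨N, hN⟩ := hs.exists_gaussNorm_map_eq hmonic hcard
  exact RamifiedField.isGreatest_of_gaussNorm_map_eq_exp k N (hN r hr)

end CyclicModule

section SupportFunction

variable {n : ℕ} {B : Fin n → ℝ} {r s : ℝ} {j : Fin n}

theorem sum_max_apply_le (hB : Antitone B) (hs : s ≤ B j) :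
    ∑ j', max (B j) (B j') ≤ ∑ j', max s (B j') + (n - 1 - j : ℕ) * (B j - s) := by
  calc ∑ j', max (B j) (B j')
      ≤ ∑ j', (max s (B j') + if j' ∈ Finset.Ioi j then B j - s else 0) := by
        refine Finset.sum_le_sum fun j' _ => ?_
        split_ifs with hj
        · exact max_le (by linarith [le_max_left s (B j')]) (by linarith [le_max_right s (B j')])
        · have hBj : B j ≤ B j' := hB (by simpa using hj)
          rw [max_eq_right hBj, add_zero]
          exact le_max_right _ _
    _ = ∑ j', max s (B j') + (n - 1 - j : ℕ) * (B j - s) := by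
        rw [Finset.sum_add_distrib, Finset.sum_ite_mem, Finset.univ_inter, Finset.sum_const,
          Fin.card_Ioi, nsmul_eq_mul]

theorem sum_max_add_le (hB : Antitone B) (hr : B j ≤ r) (hrs : r ≤ s) :
    ∑ j', max r (B j') + (n - j : ℕ) * (s - r) ≤ ∑ j', max s (B j') := by
  calc ∑ j', max r (B j') + (n - j : ℕ) * (s - r)
      = ∑ j', (max r (B j') + if j' ∈ Finset.Ici j then s - r else 0) := by
        rw [Finset.sum_add_distrib, Finset.sum_ite_mem, Finset.univ_inter, Finset.sum_const,
          Fin.card_Ici, nsmul_eq_mul]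
    _ ≤ ∑ j', max s (B j') := by
        refine Finset.sum_le_sum fun j' _ => ?_
        split_ifs with hj
        · have hBj : B j' ≤ r := (hB (by simpa using hj)).trans hr
          rw [max_eq_left hBj, max_eq_left (hBj.trans hrs), add_sub_cancel]
        · rw [add_zero]
          exact max_le_max_right _ hrs

variable {S : Set ℕ} {o : ℕ → ℝ} {h i : ℕ}

theorem sum_max_le_of_support (hS : ∀ l ∈ S, l ≤ n)
    (hsum : ∀ r, 1 < r → IsGreatest ((fun l : ℕ => r * l - o l) '' S) (∑ j, max r (B j)))
    (hs : 1 ≤ s) (hi : ∀ l ∈ S, s * l - o l ≤ s * i - o i) :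
    ∑ j, max s (B j) ≤ s * i - o i := by
  refine le_of_forall_pos_le_add fun ε hε => ?_
  have hr : s < s + ε / (n + 1) := lt_add_of_pos_right _ (by positivity)
  obtain ⟨l, hl, heq⟩ := (hsum _ (hs.trans_lt hr)).1
  have hln : ε / (n + 1) * l ≤ ε := by
    rw [div_mul_eq_mul_div, div_le_iff₀ (by positivity)]
    have : (l : ℝ) ≤ n := by exact_mod_cast hS l hl
    gcongr
    linarith
  calc ∑ j, max s (B j) ≤ ∑ j, max (s + ε / (n + 1)) (B j) :=
        Finset.sum_le_sum fun j _ => max_le_max_right _ hr.le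
    _ = s * l - o l + ε / (n + 1) * l := by rw [← heq]; ring
    _ ≤ s * i - o i + ε := add_le_add (hi l hl) hln

theorem apply_le_of_support (hB : Antitone B) (hS : ∀ l ∈ S, l ≤ n)
    (hsum : ∀ r, 1 < r → IsGreatest ((fun l : ℕ => r * l - o l) '' S) (∑ j, max r (B j)))
    (hs : 1 ≤ s) (hiS : i ∈ S) (hi : ∀ l ∈ S, s * l - o l ≤ s * i - o i) (hj : n ≤ j + i) :
    B j ≤ s := by
  by_contra! hlt
  have hsupport := (hsum (B j) (hs.trans_lt hlt)).2 ⟨i, hiS, rfl⟩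
  have hle := sum_max_le_of_support hS hsum hs hi
  have hgrowth := sum_max_apply_le hB hlt.le
  have hcard : ((n - 1 - j : ℕ) : ℝ) + 1 ≤ i := by
    exact_mod_cast (by omega : n - 1 - (j : ℕ) + 1 ≤ i)
  have := mul_le_mul_of_nonneg_right hcard (sub_nonneg.mpr hlt.le)
  linarith

theorem le_apply_of_support (hB : Antitone B) (hB₁ : ∀ j, 1 ≤ B j) (hS : ∀ l ∈ S, l ≤ n)
    (hsum : ∀ r, 1 < r → IsGreatest ((fun l : ℕ => r * l - o l) '' S) (∑ j, max r (B j)))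
    (hs : 1 ≤ s) (hhS : h ∈ S) (hh : ∀ l ∈ S, s * l - o l ≤ s * h - o h) (hj : j + h < n) :
    s ≤ B j := by
  by_contra! hlt
  obtain ⟨r, hjr, hrs⟩ := exists_between hlt
  have hsupport := (hsum r ((hB₁ j).trans_lt hjr)).2 ⟨h, hhS, rfl⟩
  have hle := sum_max_le_of_support hS hsum hs hh
  have hgrowth := sum_max_add_le hB hjr.le hrs.le
  have hcard : (h : ℝ) + 1 ≤ (n - j : ℕ) := by exact_mod_cast (by omega : h + 1 ≤ n - (j : ℕ))
  have := mul_le_mul_of_nonneg_right hcard (sub_nonneg.mpr hrs.le)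
  linarith

end SupportFunction

section LowerHull

/-- The lower boundary of the convex hull of a set of points of the plane. -/
def lowerHull (A : Set (ℝ × ℝ)) (x : ℝ) : EReal :=
  ⨅ z ∈ {z : ℝ | (x, z) ∈ convexHull ℝ A}, (z : EReal)

variable {A : Set (ℝ × ℝ)} {a b x z : ℝ}

theorem lowerHull_le (h : (x, z) ∈ convexHull ℝ A) : lowerHull A x ≤ z :=
  iInf₂_le z h

theorem le_of_mem_convexHull (h : ∀ P ∈ A, a * P.1 + b ≤ P.2) (hz : (x, z) ∈ convexHull ℝ A) :
    a * x + b ≤ z := by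
  have hconvex : Convex ℝ {P : ℝ × ℝ | P.2 - a * P.1 ≥ b} :=
    convex_halfSpace_ge (LinearMap.isLinear (LinearMap.snd ℝ ℝ ℝ - a • LinearMap.fst ℝ ℝ ℝ)) b
  have hmem := convexHull_min (fun P hP => le_sub_iff_add_le'.mpr (h P hP)) hconvex hz
  exact le_sub_iff_add_le'.mp hmem

theorem le_lowerHull (h : ∀ P ∈ A, a * P.1 + b ≤ P.2) (x : ℝ) :
    ((a * x + b : ℝ) : EReal) ≤ lowerHull A x :=
  le_iInf₂ fun _ hz => EReal.coe_le_coe_iff.mpr (le_of_mem_convexHull h hz)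

theorem lowerHull_eq_top {y : ℝ} (h : ∀ P ∈ A, P.1 ≤ y) (hy : y < x) : lowerHull A x = ⊤ := by
  have hconvex : Convex ℝ {P : ℝ × ℝ | P.1 ≤ y} :=
    convex_halfSpace_le (LinearMap.isLinear (LinearMap.fst ℝ ℝ ℝ)) y
  exact iInf₂_eq_top.mpr fun z hz => absurd (convexHull_min h hconvex hz) hy.not_ge

theorem lowerHull_eq {u w : ℝ} (h : ∀ P ∈ A, a * P.1 + b ≤ P.2) (hu : (u, a * u + b) ∈ A)
    (hw : (w, a * w + b) ∈ A) (hux : u ≤ x) (hxw : x ≤ w) :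
    lowerHull A x = ((a * x + b : ℝ) : EReal) := by
  refine le_antisymm (lowerHull_le ?_) (le_lowerHull h x)
  rcases hux.eq_or_lt with rfl | hux
  · exact subset_convexHull ℝ A hu
  have huw : 0 < w - u := by linarith
  have hsegment := (convex_convexHull ℝ A) (subset_convexHull ℝ A hu) (subset_convexHull ℝ A hw)
    (div_nonneg (sub_nonneg.mpr hxw) huw.le) (div_nonneg (sub_nonneg.mpr hux.le) huw.le)
    (by field_simp; ring)
  convert hsegment using 1
  ext <;> simp only [Prod.fst_add, Prod.snd_add, Prod.smul_fst, Prod.smul_snd, smul_eq_mul] <;>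
    field_simp <;> ring

end LowerHull

section Polygon

/-- The points `(-i, yᵢ)` for `i ∈ S`. -/
def polygonPoints (S : Finset ℕ) (y : ℕ → ℝ) : Set (ℝ × ℝ) := {P | ∃ i ∈ S, P = (-(i : ℝ), y i)}

/-- The determinant measuring how far the point `(-i, yᵢ)` lies below the line through `(-h, yₕ)`
and `(-j, yⱼ)`, if `h < i < j`; it is antisymmetric in `h, i, j`. The values may lie in any
commutative ring, so that real heights can be compared with integral ones. -/
def cross {R : Type*} [CommRing R] (y : ℕ → R) (h i j : ℕ) : R :=
  ((i : R) - h) * y j + ((j : R) - i) * y h - ((j : R) - h) * y i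

/-- The slope of the segment from `(-i, yᵢ)` to `(-h, yₕ)`. -/
def chordSlope (y : ℕ → ℝ) (h i : ℕ) : ℝ := (y h - y i) / ((i : ℝ) - h)

/-- The point `(-i, yᵢ)` lies strictly below all chords between points on either side. -/
def IsVertex (S : Finset ℕ) (y : ℕ → ℝ) (i : ℕ) : Prop :=
  i ∈ S ∧ ∀ h ∈ S, ∀ j ∈ S, h < i → i < j → 0 < cross y h i j

/-- No point lies below the line through `(-i, yᵢ)` and `(-h, yₕ)`, where `-i < -h`: the segment
between them is part of the lower boundary of the convex hull. -/
structure IsEdge (S : Finset ℕ) (y : ℕ → ℝ) (h i : ℕ) : Prop where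
  right_mem : h ∈ S
  left_mem : i ∈ S
  lt : h < i
  cross_nonneg : ∀ l ∈ S, 0 ≤ cross y h i l

/-- No point lies below the line of slope `a` through `(-i, yᵢ)`. -/
def IsSupportSlope (S : Finset ℕ) (y : ℕ → ℝ) (i : ℕ) (a : ℝ) : Prop :=
  ∀ l ∈ S, y i + a * ((i : ℝ) - l) ≤ y l

variable {S : Finset ℕ} {y : ℕ → ℝ} {h i j l : ℕ} {a b x : ℝ}

theorem natCast_sub_pos (hhi : h < i) : (0 : ℝ) < (i : ℝ) - h :=
  sub_pos.mpr (by exact_mod_cast hhi)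

theorem chordSlope_mul (y : ℕ → ℝ) (hhi : h < i) : chordSlope y h i * ((i : ℝ) - h) = y h - y i :=
  div_mul_cancel₀ _ (natCast_sub_pos hhi).ne'

theorem cross_rotate {R : Type*} [CommRing R] (y : ℕ → R) (h i j : ℕ) :
    cross y i j h = cross y h i j := by
  rw [cross, cross]
  ring

theorem cross_eq_chordSlope_sub (y : ℕ → ℝ) (hhi : h < i) (hij : i < j) :
    cross y h i j = ((i : ℝ) - h) * ((j : ℝ) - i) * (chordSlope y h i - chordSlope y i j) := by
  rw [cross]
  linear_combination (i - h : ℝ) * chordSlope_mul y hij - (j - i : ℝ) * chordSlope_mul y hhi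

theorem cross_swap {R : Type*} [CommRing R] (y : ℕ → R) (h i j : ℕ) :
    cross y h j i = -cross y h i j := by
  rw [cross, cross]
  ring

theorem cross_nonneg_iff (y : ℕ → ℝ) (hhi : h < i) (l : ℕ) :
    0 ≤ cross y h i l ↔ y i + chordSlope y h i * ((i : ℝ) - l) ≤ y l := by
  have hcross : cross y h i l =
      ((i : ℝ) - h) * (y l - (y i + chordSlope y h i * ((i : ℝ) - l))) := by
    rw [cross]
    linear_combination ((i : ℝ) - l) * chordSlope_mul y hhi
  rw [hcross, mul_nonneg_iff_of_pos_left (natCast_sub_pos hhi), sub_nonneg]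

theorem isSupportSlope_iff : IsSupportSlope S y i a ↔
    (∀ l ∈ S, i < l → chordSlope y i l ≤ a) ∧ ∀ l ∈ S, l < i → a ≤ chordSlope y l i := by
  have hleft : ∀ l, i < l → (chordSlope y i l ≤ a ↔ y i + a * ((i : ℝ) - l) ≤ y l) := by
    intro l hil
    rw [chordSlope, div_le_iff₀ (natCast_sub_pos hil)]
    constructor <;> intro hle <;> linarith
  have hright : ∀ l, l < i → (a ≤ chordSlope y l i ↔ y i + a * ((i : ℝ) - l) ≤ y l) := by
    intro l hli
    rw [chordSlope, le_div_iff₀ (natCast_sub_pos hli)]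
    constructor <;> intro hle <;> linarith
  refine ⟨fun ha => ⟨fun l hl hil => (hleft l hil).mpr (ha l hl),
    fun l hl hli => (hright l hli).mpr (ha l hl)⟩, fun ha l hl => ?_⟩
  rcases lt_trichotomy l i with hli | rfl | hil
  · exact (hright l hli).mp (ha.2 l hl hli)
  · rw [sub_self, mul_zero, add_zero]
  · exact (hleft l hil).mp (ha.1 l hl hil)

theorem IsSupportSlope.le_of_lt (ha : IsSupportSlope S y h a) (hb : IsSupportSlope S y i b)
    (hhi : h < i) (hh : h ∈ S) (hi : i ∈ S) : b ≤ a := by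
  refine le_of_mul_le_mul_right ?_ (natCast_sub_pos hhi)
  linarith [ha i hi, hb h hh]

theorem IsSupportSlope.le_lowerHull (ha : IsSupportSlope S y i a) (x : ℝ) :
    ((y i + a * (x + i) : ℝ) : EReal) ≤ lowerHull (polygonPoints S y) x := by
  have hle := DiffMod.le_lowerHull (A := polygonPoints S y) (a := a) (b := y i + a * i) (by
    rintro _ ⟨l, hl, rfl⟩
    linarith [ha l hl]) x
  convert hle using 2
  ring

theorem lowerHull_polygonPoints_le (hi : i ∈ S) :
    lowerHull (polygonPoints S y) (-(i : ℝ)) ≤ y i :=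
  lowerHull_le (subset_convexHull ℝ _ ⟨i, hi, rfl⟩)

theorem IsEdge.isSupportSlope_left (he : IsEdge S y h i) :
    IsSupportSlope S y i (chordSlope y h i) := fun l hl =>
  (cross_nonneg_iff y he.lt l).mp (he.cross_nonneg l hl)

theorem IsEdge.isSupportSlope_right (he : IsEdge S y h i) :
    IsSupportSlope S y h (chordSlope y h i) := fun l hl => by
  linarith [he.isSupportSlope_left l hl, chordSlope_mul y he.lt]

theorem IsEdge.chordSlope_le_chordSlope {h' i' : ℕ} (he : IsEdge S y h i)
    (he' : IsEdge S y h' i') (hle : i ≤ h') : chordSlope y h' i' ≤ chordSlope y h i :=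
  he.isSupportSlope_right.le_of_lt he'.isSupportSlope_right (he.lt.trans_le hle) he.right_mem
    he'.right_mem

theorem IsEdge.lowerHull_eq (he : IsEdge S y h i) (hx : -(i : ℝ) ≤ x) (hx' : x ≤ -(h : ℝ)) :
    lowerHull (polygonPoints S y) x = ((y i + chordSlope y h i * (x + i) : ℝ) : EReal) := by
  rw [DiffMod.lowerHull_eq (a := chordSlope y h i) (b := y i + chordSlope y h i * i) _ _ _ hx hx']
  · congr 1
    ring
  · rintro _ ⟨l, hl, rfl⟩
    linarith [he.isSupportSlope_left l hl]
  · exact ⟨i, he.left_mem, Prod.ext rfl (by ring)⟩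
  · exact ⟨h, he.right_mem, Prod.ext rfl (by linarith [chordSlope_mul y he.lt])⟩

theorem IsEdge.lowerHull_left (he : IsEdge S y h i) :
    lowerHull (polygonPoints S y) (-(i : ℝ)) = y i := by
  rw [he.lowerHull_eq le_rfl (neg_le_neg (by exact_mod_cast he.lt.le)), neg_add_cancel, mul_zero,
    add_zero]

theorem IsEdge.lowerHull_right (he : IsEdge S y h i) :
    lowerHull (polygonPoints S y) (-(h : ℝ)) = y h := by
  rw [he.lowerHull_eq (neg_le_neg (by exact_mod_cast he.lt.le)) le_rfl, neg_add_eq_sub,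
    chordSlope_mul y he.lt, add_sub_cancel]

theorem lowerHull_polygonPoints_eq_top (hx : ∀ l ∈ S, -x < (l : ℝ)) :
    lowerHull (polygonPoints S y) x = ⊤ := by
  rcases S.eq_empty_or_nonempty with rfl | hS
  · exact lowerHull_eq_top (y := x - 1) (by rintro _ ⟨l, hl, rfl⟩; simp at hl) (by linarith)
  · refine lowerHull_eq_top (y := -(S.min' hS : ℝ)) ?_ (by linarith [hx _ (S.min'_mem hS)])
    rintro _ ⟨l, hl, rfl⟩
    exact neg_le_neg (by exact_mod_cast S.min'_le l hl)

theorem IsVertex.exists_isSupportSlope_lt (hi : IsVertex S y i) :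
    ∃ a b, a < b ∧ IsSupportSlope S y i a ∧ IsSupportSlope S y i b := by
  let left : Finset ℝ := (S.filter (i < ·)).image (chordSlope y i)
  let right : Finset ℝ := (S.filter (· < i)).image fun h => chordSlope y h i
  have hlt : ∀ a ∈ left, ∀ b ∈ right, a < b := by
    simp only [left, right, Finset.mem_image, Finset.mem_filter]
    rintro _ ⟨j, ⟨hj, hij⟩, rfl⟩ _ ⟨h, ⟨hh, hhi⟩, rfl⟩
    have hpos := hi.2 h hh j hj hhi hij
    rw [cross_eq_chordSlope_sub y hhi hij] at hpos
    exact sub_pos.mp ((mul_pos_iff_of_pos_left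
      (mul_pos (natCast_sub_pos hhi) (natCast_sub_pos hij))).mp hpos)
  have hsupport : ∀ a, (∀ b ∈ left, b < a) → (∀ b ∈ right, a < b) → IsSupportSlope S y i a :=
    fun a hl hr => isSupportSlope_iff.mpr
      ⟨fun l hl' hil => (hl _ (Finset.mem_image_of_mem _ (Finset.mem_filter.mpr ⟨hl', hil⟩))).le,
        fun l hl' hli => (hr _ (Finset.mem_image_of_mem _ (Finset.mem_filter.mpr ⟨hl', hli⟩))).le⟩
  obtain ⟨a, hal, har⟩ := Order.exists_between_finsets left right hlt
  obtain ⟨b, hbl, hbr⟩ := Order.exists_between_finsets (insert a left) right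
    (Finset.forall_mem_insert _ _ _ |>.mpr ⟨har, hlt⟩)
  rw [Finset.forall_mem_insert] at hbl
  exact ⟨a, b, hbl.1, hsupport a hal har, hsupport b hbl.2 hbr⟩

/-- Among the chords over a point that is not a vertex, the lowest one over it is an edge. -/
theorem exists_isEdge_of_not_isVertex (hi : ¬ IsVertex S y i) {h₀ j₀ : ℕ} (hh₀ : h₀ ∈ S)
    (hh₀i : h₀ < i) (hj₀ : j₀ ∈ S) (hij₀ : i < j₀) :
    ∃ h j, IsEdge S y h j ∧ h < i ∧ i < j := by
  let chordHeight (p : ℕ × ℕ) : ℝ := y p.2 + chordSlope y p.1 p.2 * ((p.2 : ℝ) - i)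
  obtain ⟨⟨h, j⟩, hmem, hmin⟩ :=
    ((S.filter (· < i)) ×ˢ (S.filter (i < ·))).exists_min_image chordHeight
      ⟨(h₀, j₀), by simp [hh₀, hh₀i, hj₀, hij₀]⟩
  simp only [Finset.mem_product, Finset.mem_filter, Prod.forall, chordHeight] at hmem hmin
  obtain ⟨⟨hh, hhi⟩, hj, hij⟩ := hmem
  refine ⟨h, j, ⟨hh, hj, hhi.trans hij, fun l hl => ?_⟩, hhi, hij⟩
  rw [cross_nonneg_iff y (hhi.trans hij)]
  rcases lt_trichotomy l i with hli | rfl | hil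
  · have hle := hmin l j ⟨⟨hl, hli⟩, hj, hij⟩
    have hslope : chordSlope y h j ≤ chordSlope y l j :=
      le_of_mul_le_mul_right (le_of_add_le_add_left hle) (natCast_sub_pos hij)
    have := mul_le_mul_of_nonneg_right hslope (natCast_sub_pos (hli.trans hij)).le
    linarith [chordSlope_mul y (hli.trans hij)]
  · have hchord : ∃ h' ∈ S, ∃ j' ∈ S, h' < l ∧ l < j' ∧ cross y h' l j' ≤ 0 := by
      rw [IsVertex] at hi
      push Not at hi
      exact hi hl
    obtain ⟨h', hh', j', hj', hh'l, hlj', hle⟩ := hchord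
    rw [← neg_nonneg, ← cross_swap, cross_nonneg_iff y (hh'l.trans hlj')] at hle
    exact (hmin h' j' ⟨⟨hh', hh'l⟩, hj', hlj'⟩).trans hle
  · have hle := hmin h l ⟨⟨hh, hhi⟩, hl, hil⟩
    have hhl := hhi.trans hil
    have hslope : chordSlope y h l ≤ chordSlope y h j := by
      refine le_of_mul_le_mul_right ?_ (natCast_sub_pos hhi)
      linarith [chordSlope_mul y hhl, chordSlope_mul y (hhi.trans hij)]
    have := mul_le_mul_of_nonneg_right hslope (natCast_sub_pos hhl).le
    linarith [chordSlope_mul y hhl, chordSlope_mul y (hhi.trans hij)]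

theorem IsVertex.lowerHull_sub_lt (hi : IsVertex S y i) :
    lowerHull (polygonPoints S y) (-(i : ℝ)) - lowerHull (polygonPoints S y) (-(i : ℝ) - 1) <
      lowerHull (polygonPoints S y) (-(i : ℝ) + 1) - lowerHull (polygonPoints S y) (-(i : ℝ)) := by
  obtain ⟨a, b, hab, ha, hb⟩ := hi.exists_isSupportSlope_lt
  have hle := lowerHull_polygonPoints_le (y := y) hi.1
  calc lowerHull (polygonPoints S y) (-(i : ℝ)) - lowerHull (polygonPoints S y) (-(i : ℝ) - 1)
      ≤ (y i : EReal) - ((y i + a * (-(i : ℝ) - 1 + i) : ℝ) : EReal) :=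
        EReal.sub_le_sub hle (ha.le_lowerHull _)
    _ = (a : EReal) := by rw [← EReal.coe_sub]; congr 1; ring
    _ < (b : EReal) := by exact_mod_cast hab
    _ = ((y i + b * (-(i : ℝ) + 1 + i) : ℝ) : EReal) - (y i : EReal) := by
        rw [← EReal.coe_sub]; congr 1; ring
    _ ≤ lowerHull (polygonPoints S y) (-(i : ℝ) + 1) - lowerHull (polygonPoints S y) (-(i : ℝ)) :=
        EReal.sub_le_sub (hb.le_lowerHull _) hle

theorem IsEdge.lowerHull_sub_eq (he : IsEdge S y h j) (hhi : h < i) (hij : i < j) :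
    lowerHull (polygonPoints S y) (-(i : ℝ)) - lowerHull (polygonPoints S y) (-(i : ℝ) - 1) =
      lowerHull (polygonPoints S y) (-(i : ℝ) + 1) - lowerHull (polygonPoints S y) (-(i : ℝ)) := by
  have hhi' : (h : ℝ) + 1 ≤ i := by exact_mod_cast hhi
  have hij' : (i : ℝ) + 1 ≤ j := by exact_mod_cast hij
  rw [he.lowerHull_eq (x := -(i : ℝ)) (by linarith) (by linarith),
    he.lowerHull_eq (x := -(i : ℝ) - 1) (by linarith) (by linarith),
    he.lowerHull_eq (x := -(i : ℝ) + 1) (by linarith) (by linarith),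
    ← EReal.coe_sub, ← EReal.coe_sub]
  congr 1
  ring

theorem lowerHull_sub_lt_iff_isVertex (hj : j ∈ S) (hij : i < j) :
    lowerHull (polygonPoints S y) (-(i : ℝ)) - lowerHull (polygonPoints S y) (-(i : ℝ) - 1) <
      lowerHull (polygonPoints S y) (-(i : ℝ) + 1) - lowerHull (polygonPoints S y) (-(i : ℝ)) ↔
    IsVertex S y i := by
  refine ⟨fun hlt => by_contra fun hi => ?_, IsVertex.lowerHull_sub_lt⟩
  by_cases hright : ∃ h ∈ S, h < i
  · obtain ⟨h, hh, hhi⟩ := hright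
    obtain ⟨h', j', he, hh'i, hij'⟩ := exists_isEdge_of_not_isVertex hi hh hhi hj hij
    exact hlt.ne (he.lowerHull_sub_eq hh'i hij')
  · push Not at hright
    have hiS : i ∉ S := fun hiS => hi ⟨hiS, fun h hh _ _ hhi _ => absurd hhi (hright h hh).not_gt⟩
    have htop : lowerHull (polygonPoints S y) (-(i : ℝ)) = ⊤ :=
      lowerHull_polygonPoints_eq_top fun l hl => by
        rw [neg_neg]
        exact_mod_cast (hright l hl).lt_of_ne fun hil => hiS (hil ▸ hl)
    rw [htop, EReal.sub_top] at hlt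
    exact not_lt_bot hlt

theorem isVertex_of_cross_minimal (hhi : h < i) (hl : l ∈ S)
    (hle : ∀ p ∈ S, cross y h i l ≤ cross y h i p)
    (hlt : ∀ p ∈ S, l < p → cross y h i l < cross y h i p) : IsVertex S y l := by
  refine ⟨hl, fun h' hh' j' hj' hh'l hlj' => ?_⟩
  have hcombination : ((i : ℝ) - h) * cross y h' l j' =
      ((l : ℝ) - h') * (cross y h i j' - cross y h i l) +
        ((j' : ℝ) - l) * (cross y h i h' - cross y h i l) := by
    simp only [cross]
    ring
  refine pos_of_mul_pos_right (a := (i : ℝ) - h) ?_ (natCast_sub_pos hhi).le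
  rw [hcombination]
  exact add_pos_of_pos_of_nonneg
    (mul_pos (natCast_sub_pos hh'l) (sub_pos.mpr (hlt j' hj' hlj')))
    (mul_nonneg (natCast_sub_pos hlj').le (sub_nonneg.mpr (hle h' hh')))

theorem cross_nonneg_of_isVertex (hh : IsVertex S y h) (hi : IsVertex S y i) (hhi : h < i)
    (hl : l ∈ S) (hout : l ≤ h ∨ i ≤ l) : 0 ≤ cross y h i l := by
  rcases hout with hlh | hil
  · rcases hlh.eq_or_lt with rfl | hlh
    · exact le_of_eq (by rw [cross]; ring)
    · rw [cross_rotate]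
      exact (hh.2 l hl i hi.1 hlh hhi).le
  · rcases hil.eq_or_lt with rfl | hil
    · exact le_of_eq (by rw [cross]; ring)
    · exact (hi.2 h hh.1 l hl hhi hil).le

theorem isEdge_of_isVertex (hh : IsVertex S y h) (hi : IsVertex S y i) (hhi : h < i)
    (hbetween : ∀ l, h < l → l < i → ¬ IsVertex S y l) : IsEdge S y h i := by
  refine ⟨hh.1, hi.1, hhi, ?_⟩
  obtain ⟨l₀, hl₀, hmin⟩ := S.exists_min_image (cross y h i) ⟨h, hh.1⟩
  obtain ⟨l, hl, hmax⟩ := (S.filter fun l => cross y h i l = cross y h i l₀).exists_max_image id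
    ⟨l₀, by simp [hl₀]⟩
  rw [Finset.mem_filter] at hl
  have hle : ∀ p ∈ S, cross y h i l ≤ cross y h i p := fun p hp => hl.2 ▸ hmin p hp
  have hlt : ∀ p ∈ S, l < p → cross y h i l < cross y h i p := fun p hp hlp =>
    (hle p hp).lt_of_ne fun heq =>
      (hmax p (Finset.mem_filter.mpr ⟨hp, heq ▸ hl.2⟩)).not_gt hlp
  have hout : l ≤ h ∨ i ≤ l := by
    by_contra! hin
    exact hbetween l hin.1 hin.2 (isVertex_of_cross_minimal hhi hl.1 hle hlt)
  exact fun p hp => (cross_nonneg_of_isVertex hh hi hhi hl.1 hout).trans (hle p hp)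

end Polygon

section SmallRadius

open Filter Topology

variable {k : Type*} [NormedField k] {γ ρ C : ℝ} {f : LaurentSeries k}

theorem bddAbove_of_mem_analyticRing [IsUltrametricDist k] (hγ : 0 < γ)
    (hf : f ∈ analyticRing k γ) : BddAbove (Set.range fun i : ℤ => ‖f.coeff i‖ * γ ^ i) := by
  obtain ⟨m, g, hg, rfl⟩ := hf
  obtain ⟨C, hC⟩ := ((PowerSeries.isRestricted_iff' γ g).mp hg).bddAbove_range
  rw [mem_upperBounds, Set.forall_mem_range] at hC
  refine ⟨C * γ ^ (-(m : ℤ)), Set.forall_mem_range.mpr fun i => ?_⟩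
  obtain ⟨i, rfl⟩ : ∃ j : ℤ, i = j + -m := ⟨i + m, by ring⟩
  rw [HahnSeries.coeff_single_mul_add, one_mul, zpow_add₀ hγ.ne', ← mul_assoc]
  refine mul_le_mul_of_nonneg_right ?_ (by positivity)
  rcases lt_or_ge i 0 with hneg | hpos
  · rw [PowerSeries.coeff_coe, if_pos hneg, norm_zero, zero_mul]
    exact (by positivity : 0 ≤ ‖g.coeff 0‖ * γ ^ 0).trans (hC 0)
  · obtain ⟨i, rfl⟩ := Int.eq_ofNat_of_zero_le hpos
    rw [HahnSeries.ofPowerSeries_apply_coeff, zpow_natCast]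
    exact hC i

theorem norm_coeff_mul_zpow_le (hρ : 0 < ρ) (hρ' : ρ ≤ γ)
    (hC : ∀ i, ‖f.coeff i‖ * γ ^ i ≤ C)
    (hle : C * (ρ / γ) ≤ ‖f.leadingCoeff‖ * γ ^ f.order) (i : ℤ) :
    ‖f.coeff i‖ * ρ ^ i ≤ ‖f.leadingCoeff‖ * ρ ^ f.order := by
  have hγ : 0 < γ := hρ.trans_le hρ'
  have hC₀ : 0 ≤ C := (by positivity : 0 ≤ ‖f.coeff 0‖ * γ ^ (0 : ℤ)).trans (hC 0)
  have hscale : ∀ j : ℤ, γ ^ j * (ρ / γ) ^ j = ρ ^ j := fun j => by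
    rw [← mul_zpow, mul_div_cancel₀ ρ hγ.ne']
  rcases lt_trichotomy i f.order with hi | rfl | hi
  · rw [HahnSeries.coeff_eq_zero_of_lt_order hi, norm_zero, zero_mul]
    positivity
  · rw [HahnSeries.leadingCoeff_eq]
  · have hpow : (ρ / γ) ^ (i - f.order) ≤ ρ / γ := by
      obtain ⟨j, hj⟩ := Int.eq_ofNat_of_zero_le (sub_nonneg.mpr hi.le)
      rw [hj, zpow_natCast]
      exact pow_le_of_le_one (by positivity) ((div_le_one hγ).mpr hρ') (by omega)
    calc ‖f.coeff i‖ * ρ ^ i = ‖f.coeff i‖ * γ ^ i * (ρ / γ) ^ i := by rw [mul_assoc, hscale]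
      _ ≤ C * (ρ / γ) ^ i := mul_le_mul_of_nonneg_right (hC i) (by positivity)
      _ = C * (ρ / γ) ^ (i - f.order) * (ρ / γ) ^ f.order := by
          rw [mul_assoc, ← zpow_add₀ (by positivity), sub_add_cancel]
      _ ≤ C * (ρ / γ) * (ρ / γ) ^ f.order := by gcongr
      _ ≤ ‖f.leadingCoeff‖ * γ ^ f.order * (ρ / γ) ^ f.order := by gcongr
      _ = ‖f.leadingCoeff‖ * ρ ^ f.order := by rw [mul_assoc, hscale]

theorem gaussNorm_eq_of_le
    (hle : ∀ i, ‖f.coeff i‖ * ρ ^ i ≤ ‖f.leadingCoeff‖ * ρ ^ f.order) :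
    gaussNorm ρ f = ‖f.leadingCoeff‖ * ρ ^ f.order := by
  refine le_antisymm (ciSup_le hle) ?_
  rw [HahnSeries.leadingCoeff_eq]
  exact le_ciSup (f := fun i : ℤ => ‖f.coeff i‖ * ρ ^ i)
    ⟨_, Set.forall_mem_range.mpr hle⟩ f.order

theorem eventually_gaussNorm_eq (hγ : 0 < γ)
    (hf : BddAbove (Set.range fun i : ℤ => ‖f.coeff i‖ * γ ^ i)) (hf₀ : f ≠ 0) :
    ∀ᶠ ρ in 𝓝[>] (0 : ℝ), gaussNorm ρ f = ‖f.leadingCoeff‖ * ρ ^ f.order := by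
  obtain ⟨C, hC⟩ := hf
  rw [mem_upperBounds, Set.forall_mem_range] at hC
  have hlead : 0 < ‖f.leadingCoeff‖ * γ ^ f.order :=
    mul_pos (norm_pos_iff.mpr (HahnSeries.leadingCoeff_ne_zero.mpr hf₀)) (zpow_pos hγ _)
  have hlimit : Tendsto (fun ρ => C * (ρ / γ)) (𝓝[>] 0) (𝓝 0) := by
    refine Tendsto.mono_left ?_ nhdsWithin_le_nhds
    have hcontinuous : Continuous fun ρ => C * (ρ / γ) := by fun_prop
    simpa only [zero_div, mul_zero] using hcontinuous.tendsto 0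
  filter_upwards [Ioc_mem_nhdsGT hγ, hlimit.eventually (gt_mem_nhds hlead)] with ρ hρ hlt
  exact gaussNorm_eq_of_le (norm_coeff_mul_zpow_le hρ.1 hρ.2 hC hlt.le)

theorem eventually_abs_div_neg_log_lt (X : ℝ) {ε : ℝ} (hε : 0 < ε) :
    ∀ᶠ ρ in 𝓝[>] (0 : ℝ), |X / (-Real.log ρ)| < ε := by
  have hlimit : Tendsto (fun ρ => X / (-Real.log ρ)) (𝓝[>] 0) (𝓝 0) :=
    (tendsto_neg_atBot_atTop.comp Real.tendsto_log_nhdsGT_zero).const_div_atTop X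
  exact hlimit.abs.eventually (gt_mem_nhds (by rwa [abs_zero]))

theorem exists_isSmallRadius (hγ : 0 < γ) {ℓ : TwistedPolynomial (ddx k)}
    (hcoeff : ∀ i, BddAbove (Set.range fun j : ℤ => ‖(ℓ.coeff i).coeff j‖ * γ ^ j)) :
    ∃ c : ℝ, IsSmallRadius γ ℓ c := by
  have hfinite : (Set.Iic ℓ.natDegree).Finite := Set.finite_Iic _
  have hgauss := (eventually_all_finite hfinite).mpr fun i _ =>
    (eventually_all (l := 𝓝[>] (0 : ℝ))).mpr fun h0 : ℓ.coeff i ≠ 0 =>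
      eventually_gaussNorm_eq hγ (hcoeff i) h0
  have htriple := (eventually_all_finite hfinite).mpr fun h _ =>
    (eventually_all_finite hfinite).mpr fun i _ => (eventually_all_finite hfinite).mpr fun j _ =>
      eventually_abs_div_neg_log_lt (Real.log
        ((‖(ℓ.coeff i).leadingCoeff‖ / ‖(ℓ.coeff h).leadingCoeff‖) ^ (1 / ((i : ℝ) - (h : ℝ))) *
          (‖(ℓ.coeff h).leadingCoeff‖ / ‖(ℓ.coeff j).leadingCoeff‖) ^ (1 / ((j : ℝ) - (h : ℝ)))))
        (ε := 1 / ((ℓ.natDegree : ℝ) ^ 2 + 1)) (by positivity)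
  have hpair := (eventually_all_finite hfinite).mpr fun i _ =>
    (eventually_all_finite hfinite).mpr fun j _ =>
      eventually_abs_div_neg_log_lt (Real.log
        ((‖(ℓ.coeff j).leadingCoeff‖ / ‖(ℓ.coeff i).leadingCoeff‖) ^ (1 / ((j : ℝ) - (i : ℝ)))))
        (ε := 1 / ((ℓ.natDegree : ℝ) + 1)) (by positivity)
  obtain ⟨c, hc, hsubset⟩ := mem_nhdsGT_iff_exists_Ioc_subset.mp
    (hgauss.and (htriple.and (hpair.and (Ioo_mem_nhdsGT (lt_min hγ one_pos)))))
  have hlt : c < min γ 1 := (hsubset (Set.right_mem_Ioc.mpr hc)).2.2.2.2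
  exact ⟨c,
    { pos := hc
      le := (hlt.trans_le (min_le_left _ _)).le
      lt_one := hlt.trans_le (min_le_right _ _)
      gaussNorm_eq := fun ρ hρ hρc i hi h0 => (hsubset ⟨hρ, hρc⟩).1 i hi h0
      triple := fun ρ hρ hρc h i j hhi hij hj _ _ _ =>
        (hsubset ⟨hρ, hρc⟩).2.1 h ((hhi.le.trans hij).trans hj) i (hij.trans hj) j hj
      pair := fun ρ hρ hρc i j hij hj _ _ =>
        (hsubset ⟨hρ, hρc⟩).2.2.1 i (hij.le.trans hj) j hj }⟩

end SmallRadius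

section IntegerGap

variable {L b : ℝ} {z : ℤ}

theorem nonneg_of_mul_intCast_sub_nonneg (hb : |b| < L) (h : 0 ≤ L * z - b) : 0 ≤ z := by
  have hL : 0 < L := (abs_nonneg b).trans_lt hb
  have hlt : L * (-1 : ℤ) < L * z := by
    push_cast
    linarith [neg_lt_of_abs_lt hb]
  exact Int.add_one_le_of_lt (Int.cast_lt.mp (lt_of_mul_lt_mul_left hlt hL.le))

theorem mul_intCast_sub_pos_iff (hb : |b| < L) :
    0 < L * z - b ↔ 0 < z ∨ z = 0 ∧ b < 0 := by
  refine ⟨fun h => ?_, ?_⟩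
  · rcases (nonneg_of_mul_intCast_sub_nonneg hb h.le).eq_or_lt with rfl | hz
    · exact Or.inr ⟨rfl, by simpa using h⟩
    · exact Or.inl hz
  · rintro (hz | ⟨rfl, hb₀⟩)
    · have hL : 0 < L := (abs_nonneg b).trans_lt hb
      have hz₁ : (1 : ℝ) ≤ z := by exact_mod_cast hz
      linarith [le_mul_of_one_le_right hL.le hz₁, lt_of_abs_lt hb]
    · simpa using hb₀

theorem abs_lt_of_abs_div_div_lt {X D B : ℝ} (hL : 0 < L) (hD : 0 < D) (hDB : D ≤ B)
    (h : |X / D / L| < 1 / B) : |X| < L := by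
  rw [abs_div, abs_div, abs_of_pos hD, abs_of_pos hL, div_div, div_lt_iff₀ (mul_pos hD hL)] at h
  calc |X| < 1 / B * (D * L) := h
    _ = D / B * L := by ring
    _ ≤ L := mul_le_of_le_one_left hL.le ((div_le_one (hD.trans_le hDB)).mpr hDB)

end IntegerGap

section Heights

variable {k : Type*}

/-- The indices of the nonzero coefficients of a twisted polynomial. -/
def TwistedPolynomial.support {R : Type*} [CommRing R] {d : AddDerivation R}
    (p : TwistedPolynomial d) : Finset ℕ := (TwistedPolynomial.toPoly d p).support

theorem TwistedPolynomial.mem_support {R : Type*} [CommRing R] {d : AddDerivation R}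
    {p : TwistedPolynomial d} {i : ℕ} : i ∈ p.support ↔ p.coeff i ≠ 0 :=
  Polynomial.mem_support_iff

theorem TwistedPolynomial.le_natDegree_of_mem_support {R : Type*} [CommRing R]
    {d : AddDerivation R} {p : TwistedPolynomial d} {i : ℕ} (hi : i ∈ p.support) :
    i ≤ p.natDegree :=
  Polynomial.le_natDegree_of_mem_supp i hi

theorem TwistedPolynomial.Monic.natDegree_mem_support {R : Type*} [CommRing R] [Nontrivial R]
    {d : AddDerivation R} {p : TwistedPolynomial d} (hp : p.Monic) : p.natDegree ∈ p.support :=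
  Polynomial.natDegree_mem_support_of_nonzero (Polynomial.Monic.ne_zero hp)

/-- The order at `x = 0` of the `i`-th coefficient, which is `0` for a coefficient that vanishes. -/
def coeffOrder [Field k] (ℓ : TwistedPolynomial (ddx k)) (i : ℕ) : ℤ := (ℓ.coeff i).order

variable [NormedField k] {γ c ρ : ℝ} {ℓ : TwistedPolynomial (ddx k)} {h i j l : ℕ}

/-- The valuation `v_ρ(aᵢ)` of the `i`-th coefficient. -/
def height (ρ : ℝ) (ℓ : TwistedPolynomial (ddx k)) (i : ℕ) : ℝ :=
  -Real.log (gaussNorm ρ (ℓ.coeff i))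

/-- The number `log |bᵢ|`, where `bᵢ` is the lowest coefficient of the Laurent series `aᵢ`. -/
def logLead (ℓ : TwistedPolynomial (ddx k)) (i : ℕ) : ℝ :=
  Real.log ‖(ℓ.coeff i).leadingCoeff‖

theorem norm_leadingCoeff_pos (hi : i ∈ ℓ.support) : 0 < ‖(ℓ.coeff i).leadingCoeff‖ :=
  norm_pos_iff.mpr (HahnSeries.leadingCoeff_ne_zero.mpr (TwistedPolynomial.mem_support.mp hi))

theorem log_norm_div_rpow (hh : h ∈ ℓ.support) (hi : i ∈ ℓ.support) (e : ℝ) :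
    Real.log ((‖(ℓ.coeff i).leadingCoeff‖ / ‖(ℓ.coeff h).leadingCoeff‖) ^ e) =
      e * (logLead ℓ i - logLead ℓ h) := by
  rw [Real.log_rpow (div_pos (norm_leadingCoeff_pos hi) (norm_leadingCoeff_pos hh)),
    Real.log_div (norm_leadingCoeff_pos hi).ne' (norm_leadingCoeff_pos hh).ne', logLead, logLead]

namespace IsSmallRadius

theorem neg_log_pos (hc : IsSmallRadius γ ℓ c) (hρ : 0 < ρ) (hρc : ρ ≤ c) : 0 < -Real.log ρ :=
  neg_pos.mpr (Real.log_neg hρ (hρc.trans_lt hc.lt_one))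

theorem height_eq (hc : IsSmallRadius γ ℓ c) (hρ : 0 < ρ) (hρc : ρ ≤ c) (hi : i ∈ ℓ.support) :
    height ρ ℓ i = -Real.log ρ * coeffOrder ℓ i - logLead ℓ i := by
  rw [height, hc.gaussNorm_eq ρ hρ hρc i (TwistedPolynomial.le_natDegree_of_mem_support hi)
    (TwistedPolynomial.mem_support.mp hi), Real.log_mul (norm_leadingCoeff_pos hi).ne'
    (zpow_pos hρ _).ne', Real.log_zpow, coeffOrder, logLead]
  ring

theorem cross_height (hc : IsSmallRadius γ ℓ c) (hρ : 0 < ρ) (hρc : ρ ≤ c) (hh : h ∈ ℓ.support)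
    (hi : i ∈ ℓ.support) (hj : j ∈ ℓ.support) :
    cross (height ρ ℓ) h i j =
      -Real.log ρ * (cross (coeffOrder ℓ) h i j : ℤ) - cross (logLead ℓ) h i j := by
  simp only [cross, hc.height_eq hρ hρc hh, hc.height_eq hρ hρc hi, hc.height_eq hρ hρc hj]
  push_cast
  ring

theorem abs_cross_logLead_lt (hc : IsSmallRadius γ ℓ c) (hρ : 0 < ρ) (hρc : ρ ≤ c)
    (hh : h ∈ ℓ.support) (hi : i ∈ ℓ.support) (hj : j ∈ ℓ.support) (hhi : h < i) (hij : i < j) :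
    |cross (logLead ℓ) h i j| < -Real.log ρ := by
  have hpos := natCast_sub_pos hhi
  have hpos' := natCast_sub_pos (hhi.trans hij)
  have hjn : (j : ℝ) ≤ ℓ.natDegree := by
    exact_mod_cast TwistedPolynomial.le_natDegree_of_mem_support hj
  have hij' : (i : ℝ) < j := by exact_mod_cast hij
  have hbound : ((i : ℝ) - h) * ((j : ℝ) - h) ≤ (ℓ.natDegree : ℝ) ^ 2 + 1 := by
    nlinarith [h.cast_nonneg (α := ℝ)]
  have htriple := hc.triple ρ hρ hρc h i j hhi hij.le
    (TwistedPolynomial.le_natDegree_of_mem_support hj) (TwistedPolynomial.mem_support.mp hh)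
    (TwistedPolynomial.mem_support.mp hi) (TwistedPolynomial.mem_support.mp hj)
  have bh := norm_leadingCoeff_pos hh
  have bi := norm_leadingCoeff_pos hi
  have bj := norm_leadingCoeff_pos hj
  have hcross : 1 / ((i : ℝ) - h) * (logLead ℓ i - logLead ℓ h) +
      1 / ((j : ℝ) - h) * (logLead ℓ h - logLead ℓ j) =
      cross (logLead ℓ) h j i / (((i : ℝ) - h) * ((j : ℝ) - h)) := by
    rw [cross]
    field_simp
    ring
  rw [Real.log_mul (by positivity) (by positivity), log_norm_div_rpow hh hi,
    log_norm_div_rpow hj hh, hcross] at htriple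
  rw [← abs_neg, ← cross_swap]
  exact abs_lt_of_abs_div_div_lt (hc.neg_log_pos hρ hρc) (mul_pos hpos hpos') hbound htriple

theorem abs_logLead_sub_lt (hc : IsSmallRadius γ ℓ c) (hρ : 0 < ρ) (hρc : ρ ≤ c)
    (hh : h ∈ ℓ.support) (hi : i ∈ ℓ.support) (hhi : h < i) :
    |logLead ℓ i - logLead ℓ h| < -Real.log ρ := by
  have hin : (i : ℝ) ≤ ℓ.natDegree := by
    exact_mod_cast TwistedPolynomial.le_natDegree_of_mem_support hi
  have hpair := hc.pair ρ hρ hρc h i hhi (TwistedPolynomial.le_natDegree_of_mem_support hi)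
    (TwistedPolynomial.mem_support.mp hh) (TwistedPolynomial.mem_support.mp hi)
  rw [log_norm_div_rpow hh hi, one_div_mul_eq_div] at hpair
  exact abs_lt_of_abs_div_div_lt (hc.neg_log_pos hρ hρc) (natCast_sub_pos hhi)
    (by linarith [h.cast_nonneg (α := ℝ)]) hpair

theorem abs_cross_logLead_lt_of_lt (hc : IsSmallRadius γ ℓ c) (hρ : 0 < ρ) (hρc : ρ ≤ c)
    (hh : h ∈ ℓ.support) (hi : i ∈ ℓ.support) (hl : l ∈ ℓ.support) (hhi : h < i) :
    |cross (logLead ℓ) h i l| < -Real.log ρ := by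
  have hL := hc.neg_log_pos hρ hρc
  rcases lt_trichotomy l h with hlh | rfl | hhl
  · rw [cross_rotate]
    exact hc.abs_cross_logLead_lt hρ hρc hl hh hi hlh hhi
  · rwa [show cross (logLead ℓ) l i l = 0 by rw [cross]; ring, abs_zero]
  rcases lt_trichotomy l i with hli | rfl | hil
  · rw [cross_swap, abs_neg]
    exact hc.abs_cross_logLead_lt hρ hρc hh hl hi hhl hli
  · rwa [show cross (logLead ℓ) h l l = 0 by rw [cross]; ring, abs_zero]
  · exact hc.abs_cross_logLead_lt hρ hρc hh hi hl hhi hil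

theorem cross_height_pos_iff (hc : IsSmallRadius γ ℓ c) (hρ : 0 < ρ) (hρc : ρ ≤ c)
    (hh : h ∈ ℓ.support) (hi : i ∈ ℓ.support) (hj : j ∈ ℓ.support) (hhi : h < i) (hij : i < j) :
    0 < cross (height ρ ℓ) h i j ↔ 0 < cross (coeffOrder ℓ) h i j ∨
      cross (coeffOrder ℓ) h i j = 0 ∧ cross (logLead ℓ) h i j < 0 := by
  rw [hc.cross_height hρ hρc hh hi hj]
  exact mul_intCast_sub_pos_iff (hc.abs_cross_logLead_lt hρ hρc hh hi hj hhi hij)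

theorem isVertex_iff (hc : IsSmallRadius γ ℓ c) (hρ : 0 < ρ) (hρc : ρ ≤ c) (i : ℕ) :
    IsVertex ℓ.support (height ρ ℓ) i ↔ IsVertex ℓ.support (height c ℓ) i := by
  refine and_congr_right fun hi => forall₂_congr fun h hh => forall₂_congr fun j hj =>
    forall₂_congr fun hhi hij => ?_
  rw [hc.cross_height_pos_iff hρ hρc hh hi hj hhi hij,
    hc.cross_height_pos_iff hc.pos le_rfl hh hi hj hhi hij]

theorem isEdge_coeffOrder (hc : IsSmallRadius γ ℓ c) (he : IsEdge ℓ.support (height c ℓ) h i) :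
    IsEdge ℓ.support (fun l => (coeffOrder ℓ l : ℝ)) h i := by
  refine ⟨he.right_mem, he.left_mem, he.lt, fun l hl => ?_⟩
  have hcross := he.cross_nonneg l hl
  rw [hc.cross_height hc.pos le_rfl he.right_mem he.left_mem hl] at hcross
  have hnonneg := nonneg_of_mul_intCast_sub_nonneg (hc.abs_cross_logLead_lt_of_lt hc.pos le_rfl
    he.right_mem he.left_mem hl he.lt) hcross
  rw [show cross (fun l => (coeffOrder ℓ l : ℝ)) h i l = (cross (coeffOrder ℓ) h i l : ℤ) by
    simp only [cross]; push_cast; rfl]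
  exact_mod_cast hnonneg

theorem chordSlope_coeffOrder_le_neg_one (hc : IsSmallRadius γ ℓ c) (hh : h ∈ ℓ.support)
    (hi : i ∈ ℓ.support) (hhi : h < i) (hlt : chordSlope (height c ℓ) h i < Real.log c) :
    chordSlope (fun l => (coeffOrder ℓ l : ℝ)) h i ≤ -1 := by
  have hmul := mul_lt_mul_of_pos_right hlt (natCast_sub_pos hhi)
  rw [chordSlope_mul _ hhi, hc.height_eq hc.pos le_rfl hh, hc.height_eq hc.pos le_rfl hi] at hmul
  have hnonneg : 0 ≤ coeffOrder ℓ i - coeffOrder ℓ h - ((i : ℤ) - h) := by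
    refine nonneg_of_mul_intCast_sub_nonneg (hc.abs_logLead_sub_lt hc.pos le_rfl hh hi hhi) ?_
    push_cast
    linarith
  rw [chordSlope, div_le_iff₀ (natCast_sub_pos hhi)]
  have : (0 : ℝ) ≤ coeffOrder ℓ i - coeffOrder ℓ h - ((i : ℝ) - h) := by exact_mod_cast hnonneg
  linarith

end IsSmallRadius

end Heights

section NewtonPolygon

variable {k : Type*} [NormedField k] {γ c ρ : ℝ} {ℓ : TwistedPolynomial (ddx k)} {h i : ℕ}
  {m u w : ℤ}

theorem newtonPolygon_eq_lowerHull (ρ : ℝ) (ℓ : TwistedPolynomial (ddx k)) :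
    newtonPolygon ρ ℓ = lowerHull (polygonPoints ℓ.support (height ρ ℓ)) := by
  have hpoints : newtonPoints ρ ℓ = polygonPoints ℓ.support (height ρ ℓ) := by
    ext P
    exact exists_congr fun i => ⟨fun ⟨_, h0, hP⟩ => ⟨TwistedPolynomial.mem_support.mpr h0, hP⟩,
      fun ⟨hi, hP⟩ => ⟨TwistedPolynomial.le_natDegree_of_mem_support hi,
        TwistedPolynomial.mem_support.mp hi, hP⟩⟩
  rw [← hpoints]
  rfl

theorem newtonSlope_add_one (ρ : ℝ) (ℓ : TwistedPolynomial (ddx k)) (m : ℤ) :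
    newtonSlope ρ ℓ m (m + 1) = newtonPolygon ρ ℓ ((m : ℝ) + 1) - newtonPolygon ρ ℓ m := by
  rw [newtonSlope, Int.cast_add, Int.cast_one, add_sub_cancel_left, EReal.coe_one, div_one]

theorem newtonSlope_sub_one (ρ : ℝ) (ℓ : TwistedPolynomial (ddx k)) (m : ℤ) :
    newtonSlope ρ ℓ (m - 1) m = newtonPolygon ρ ℓ m - newtonPolygon ρ ℓ ((m : ℝ) - 1) := by
  rw [newtonSlope, Int.cast_sub, Int.cast_one, sub_sub_cancel, EReal.coe_one, div_one]

theorem cast_toNat_neg (hm : m ≤ 0) : ((-m).toNat : ℝ) = -m := by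
  exact_mod_cast Int.toNat_of_nonneg (neg_nonneg.mpr hm)

theorem mem_newtonBreaks_iff (hmonic : ℓ.Monic) : m ∈ newtonBreaks ρ ℓ ↔
    m = -(ℓ.natDegree : ℤ) ∨ m = 0 ∨ (-(ℓ.natDegree : ℤ) < m ∧ m < 0 ∧
      IsVertex ℓ.support (height ρ ℓ) (-m).toNat) := by
  refine or_congr_right (or_congr_right (and_congr_right fun hlt => and_congr_right fun hneg => ?_))
  rw [← lowerHull_sub_lt_iff_isVertex hmonic.natDegree_mem_support (by omega),
    ← newtonPolygon_eq_lowerHull, cast_toNat_neg hneg.le, neg_neg, newtonSlope_add_one,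
    newtonSlope_sub_one]

theorem nonpos_of_mem_newtonBreaks (hm : m ∈ newtonBreaks ρ ℓ) : m ≤ 0 := by
  rcases hm with rfl | rfl | h
  · exact neg_nonpos.mpr (Int.natCast_nonneg _)
  · exact le_rfl
  · exact h.2.1.le

theorem IsSmallRadius.newtonBreaks_eq (hc : IsSmallRadius γ ℓ c) (hmonic : ℓ.Monic) (hρ : 0 < ρ)
    (hρc : ρ ≤ c) : newtonBreaks ρ ℓ = newtonBreaks c ℓ := by
  ext m
  rw [mem_newtonBreaks_iff hmonic, mem_newtonBreaks_iff hmonic, hc.isVertex_iff hρ hρc]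

theorem isVertex_of_mem_newtonBreaks (hmonic : ℓ.Monic) (hm : m ∈ newtonBreaks ρ ℓ)
    (h₀ : m = 0 → 0 ∈ ℓ.support) : IsVertex ℓ.support (height ρ ℓ) (-m).toNat := by
  rcases (mem_newtonBreaks_iff hmonic).mp hm with rfl | rfl | h
  · rw [neg_neg, Int.toNat_natCast]
    exact ⟨hmonic.natDegree_mem_support, fun _ _ j hj _ hlt =>
      absurd (TwistedPolynomial.le_natDegree_of_mem_support hj) hlt.not_ge⟩
  · exact ⟨h₀ rfl, fun h _ _ _ hlt _ => absurd hlt h.not_lt_zero⟩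
  · exact h.2.2

theorem isEdge_of_mem_newtonBreaks (hmonic : ℓ.Monic) (hu : u ∈ newtonBreaks ρ ℓ)
    (hw : w ∈ newtonBreaks ρ ℓ) (huw : u < w)
    (hconsecutive : ∀ m ∈ newtonBreaks ρ ℓ, u < m → w ≤ m) (h₀ : w = 0 → 0 ∈ ℓ.support) :
    IsEdge ℓ.support (height ρ ℓ) (-w).toNat (-u).toNat := by
  have hw₀ := nonpos_of_mem_newtonBreaks hw
  refine isEdge_of_isVertex (isVertex_of_mem_newtonBreaks hmonic hw h₀)
    (isVertex_of_mem_newtonBreaks hmonic hu fun hu₀ => absurd hu₀ (by omega)) (by omega)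
    fun l hwl hlu hl => ?_
  have hu₀ : -(ℓ.natDegree : ℤ) ≤ u := by
    rcases hu with rfl | rfl | hu
    · exact le_rfl
    · omega
    · exact hu.1.le
  have hbreak : -(l : ℤ) ∈ newtonBreaks ρ ℓ := (mem_newtonBreaks_iff hmonic).mpr
    (Or.inr (Or.inr ⟨by omega, by omega, by rwa [neg_neg, Int.toNat_natCast]⟩))
  have := hconsecutive _ hbreak (by omega)
  omega

theorem IsEdge.newtonSlope_eq (he : IsEdge ℓ.support (height ρ ℓ) (-w).toNat (-u).toNat)
    (hu : u ≤ 0) (hw : w ≤ 0) :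
    newtonSlope ρ ℓ u w = (chordSlope (height ρ ℓ) (-w).toNat (-u).toNat : EReal) := by
  have hleft := he.lowerHull_left
  have hright := he.lowerHull_right
  rw [cast_toNat_neg hu, neg_neg] at hleft
  rw [cast_toNat_neg hw, neg_neg] at hright
  rw [newtonSlope, newtonPolygon_eq_lowerHull, hleft, hright, ← EReal.coe_sub, ← EReal.coe_div,
    chordSlope, cast_toNat_neg hu, cast_toNat_neg hw]
  congr 2
  ring

theorem zero_mem_support_of_isEffective (hu : u < 0) (hmem : (-u).toNat ∈ ℓ.support)
    (heff : IsEffective ρ ℓ u 0) : 0 ∈ ℓ.support := by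
  by_contra h₀
  have htop : newtonPolygon ρ ℓ (0 : ℤ) = ⊤ := by
    rw [newtonPolygon_eq_lowerHull]
    refine lowerHull_polygonPoints_eq_top fun l hl => ?_
    rw [Int.cast_zero, neg_zero]
    exact_mod_cast Nat.pos_of_ne_zero fun hl₀ => h₀ (hl₀ ▸ hl)
  have hne : newtonPolygon ρ ℓ u ≠ ⊤ := by
    have hle := lowerHull_polygonPoints_le (y := height ρ ℓ) hmem
    rw [cast_toNat_neg hu.le, neg_neg, ← newtonPolygon_eq_lowerHull] at hle
    exact ne_top_of_le_ne_top (EReal.coe_ne_top _) hle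
  have hpos : (0 : EReal) < (((0 : ℤ) : ℝ) - (u : ℝ) : ℝ) := by
    rw [Int.cast_zero, zero_sub]
    exact_mod_cast neg_pos.mpr hu
  rw [IsEffective, newtonSlope, htop, EReal.top_sub hne,
    EReal.top_div_of_pos_ne_top hpos (EReal.coe_ne_top _)] at heff
  exact not_top_lt heff

variable {r : ℕ} {m : Fin (r + 1) → ℤ} {s t : Fin r}

theorem isEdge_of_range_eq_newtonBreaks (hmonic : ℓ.Monic) (hm : StrictMono m)
    (hrange : Set.range m = newtonBreaks ρ ℓ) (s : Fin r) (h₀ : m s.succ = 0 → 0 ∈ ℓ.support) :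
    IsEdge ℓ.support (height ρ ℓ) (-(m s.succ)).toNat (-(m s.castSucc)).toNat := by
  have hmem : ∀ v, m v ∈ newtonBreaks ρ ℓ := fun v => hrange ▸ Set.mem_range_self v
  refine isEdge_of_mem_newtonBreaks hmonic (hmem _) (hmem _) (hm s.castSucc_lt_succ) ?_ h₀
  rw [← hrange, Set.forall_mem_range]
  exact fun v hv => hm.monotone (Fin.castSucc_lt_iff_succ_le.mp (hm.lt_iff_lt.mp hv))

theorem isEdge_of_isEffective (hmonic : ℓ.Monic) (hm : StrictMono m)
    (hrange : Set.range m = newtonBreaks ρ ℓ) (heff : IsEffective ρ ℓ (m t.castSucc) (m t.succ))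
    (hst : s ≤ t) :
    IsEdge ℓ.support (height ρ ℓ) (-(m s.succ)).toNat (-(m s.castSucc)).toNat := by
  have hmem : ∀ v, m v ∈ newtonBreaks ρ ℓ := fun v => hrange ▸ Set.mem_range_self v
  refine isEdge_of_range_eq_newtonBreaks hmonic hm hrange s fun hs₀ => ?_
  have hs : s = t := by
    refine hst.antisymm (Fin.succ_le_succ_iff.mp (hm.le_iff_le.mp ?_))
    exact hs₀ ▸ nonpos_of_mem_newtonBreaks (hmem t.succ)
  subst hs
  have hneg : m s.castSucc < 0 := hs₀ ▸ hm s.castSucc_lt_succ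
  refine zero_mem_support_of_isEffective hneg ?_ (hs₀ ▸ heff)
  exact (isVertex_of_mem_newtonBreaks hmonic (hmem _) fun h => absurd h hneg.ne).1

theorem chordSlope_lt_log_of_isEffective (hmonic : ℓ.Monic) (hm : StrictMono m)
    (hrange : Set.range m = newtonBreaks ρ ℓ) (heff : IsEffective ρ ℓ (m t.castSucc) (m t.succ))
    (hst : s ≤ t) :
    chordSlope (height ρ ℓ) (-(m s.succ)).toNat (-(m s.castSucc)).toNat < Real.log ρ := by
  have hnonpos : ∀ v, m v ≤ 0 := fun v =>
    nonpos_of_mem_newtonBreaks (hrange ▸ Set.mem_range_self v)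
  have hs := isEdge_of_isEffective hmonic hm hrange heff hst
  have ht := isEdge_of_isEffective hmonic hm hrange heff le_rfl
  have hlt : chordSlope (height ρ ℓ) (-(m t.succ)).toNat (-(m t.castSucc)).toNat < Real.log ρ := by
    rw [IsEffective, ht.newtonSlope_eq (hnonpos _) (hnonpos _)] at heff
    exact_mod_cast heff
  rcases hst.eq_or_lt with rfl | hst
  · exact hlt
  · refine (ht.chordSlope_le_chordSlope hs ?_).trans_lt hlt
    have := hm.monotone (Fin.succ_le_castSucc_iff.mpr hst)
    omega

end NewtonPolygon

section FormalSlopes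

variable {k : Type*} [Field k] [CharZero k] {ℓ : TwistedPolynomial (ddx k)} {n h i : ℕ}
  {β : Fin n → ℚ} {j : Fin n}

theorem IsFormalSlopes.nonneg {M : Type*} [AddCommGroup M] [Module (LaurentSeries k) M]
    {D : DifferentialOperator (ddx k) M} {s : Multiset ℚ} (hs : IsFormalSlopes D s) :
    ∀ β ∈ s, 0 ≤ β := by
  obtain ⟨N, r, e, f, -, rfl⟩ := hs
  exact Multiset.forall_mem_map_iff.mpr fun i _ => le_max_left _ _

theorem IsFormalSlopes.isGreatest_support (hs : IsFormalSlopes (cyclicOperator ℓ)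
    (Finset.univ.val.map β)) (hmonic : ℓ.Monic) (hn : ℓ.natDegree = n) {r : ℝ} (hr : 1 < r) :
    IsGreatest ((fun l : ℕ => r * l - coeffOrder ℓ l) '' ℓ.support)
      (∑ j, max r (1 + (β j : ℝ))) := by
  have hgreatest := hs.isGreatest hmonic (by simp [hn]) hr
  rw [Multiset.map_map] at hgreatest
  rwa [show (ℓ.support : Set ℕ) = {i | ℓ.coeff i ≠ 0} from
    Set.ext fun _ => TwistedPolynomial.mem_support]

theorem IsFormalSlopes.eq_of_isEdge (hs : IsFormalSlopes (cyclicOperator ℓ)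
    (Finset.univ.val.map β)) (hβ : Antitone β) (hmonic : ℓ.Monic) (hn : ℓ.natDegree = n)
    (he : IsEdge ℓ.support (fun l => (coeffOrder ℓ l : ℝ)) h i)
    (hle : chordSlope (fun l => (coeffOrder ℓ l : ℝ)) h i ≤ -1)
    (hj : n ≤ j + i) (hj' : j + h < n) :
    β j = -1 - ((coeffOrder ℓ h : ℚ) - coeffOrder ℓ i) / ((i : ℚ) - h) := by
  set o : ℕ → ℝ := fun l => coeffOrder ℓ l
  have hB : Antitone fun j => 1 + (β j : ℝ) := fun a b hab =>
    add_le_add le_rfl (Rat.cast_le.mpr (hβ hab))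
  have hB₁ : ∀ j, 1 ≤ 1 + (β j : ℝ) := fun j =>
    le_add_of_nonneg_right (Rat.cast_nonneg.mpr
      (hs.nonneg _ (Multiset.mem_map_of_mem _ (Finset.mem_univ_val j))))
  have hS : ∀ l ∈ (ℓ.support : Set ℕ), l ≤ n := fun l hl =>
    hn ▸ TwistedPolynomial.le_natDegree_of_mem_support hl
  have hsum := fun r (hr : (1 : ℝ) < r) => hs.isGreatest_support hmonic hn hr
  have hs₁ : 1 ≤ -chordSlope o h i := le_neg_of_le_neg hle
  have hslope : 1 + (β j : ℝ) = -chordSlope o h i := by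
    refine le_antisymm (apply_le_of_support hB hS hsum hs₁ he.left_mem (fun l hl => ?_) hj)
      (le_apply_of_support hB hB₁ hS hsum hs₁ he.right_mem (fun l hl => ?_) hj')
    · linarith [he.isSupportSlope_left l hl]
    · linarith [he.isSupportSlope_right l hl]
  have hcast : (β j : ℝ) = -1 - (coeffOrder ℓ h - coeffOrder ℓ i) / ((i : ℝ) - h) :=
    show (β j : ℝ) = -1 - chordSlope o h i by linarith
  exact_mod_cast hcast

end FormalSlopes

end DiffMod

end

theorem proposition5p6_general {k : Type*} [NormedField k] [CharZero k]
    {γ : ℝ} (hγ₀ : 0 < γ)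
    (ℓ : TwistedPolynomial (ddx k)) (n : ℕ) (hdeg : ℓ.natDegree = n) (hmonic : ℓ.Monic)
    (hcoeff : ∀ i, BddAbove (Set.range fun j : ℤ => ‖(ℓ.coeff i).coeff j‖ * γ ^ j)) :
    (∃ c : ℝ, IsSmallRadius γ ℓ c) ∧
    ∀ c : ℝ, IsSmallRadius γ ℓ c →
      (∀ ρ : ℝ, 0 < ρ → ρ ≤ c → newtonBreaks ρ ℓ = newtonBreaks c ℓ) ∧
      ∀ β : Fin n → ℚ, Antitone β →
        IsFormalSlopes (cyclicOperator ℓ) (Finset.univ.val.map β) →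
        ∀ (r : ℕ) (m : Fin (r + 1) → ℤ), StrictMono m → Set.range m = newtonBreaks c ℓ →
        ∀ t : Fin r, IsEffective c ℓ (m t.castSucc) (m t.succ) →
        ∀ s : Fin r, s ≤ t →
          ℓ.coeff (-(m s.castSucc)).toNat ≠ 0 ∧ ℓ.coeff (-(m s.succ)).toNat ≠ 0 ∧
          ∀ j : Fin n, m s.castSucc + n ≤ (j : ℕ) → ((j : ℕ) : ℤ) < m s.succ + n →
            β j = -1 - (((ℓ.coeff (-(m s.succ)).toNat).order : ℚ) -
                ((ℓ.coeff (-(m s.castSucc)).toNat).order : ℚ)) /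
              ((m s.succ : ℚ) - (m s.castSucc : ℚ)) := by
  refine ⟨exists_isSmallRadius hγ₀ hcoeff, fun c hc =>
    ⟨fun ρ hρ hρc => hc.newtonBreaks_eq hmonic hρ hρc, ?_⟩⟩
  intro β hβ hs r m hm hrange t heff s hst
  have hnonpos : ∀ v, m v ≤ 0 := fun v =>
    nonpos_of_mem_newtonBreaks (hrange ▸ Set.mem_range_self v)
  have he := isEdge_of_isEffective hmonic hm hrange heff hst
  have hle := hc.chordSlope_coeffOrder_le_neg_one he.right_mem he.left_mem he.lt
    (chordSlope_lt_log_of_isEffective hmonic hm hrange heff hst)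
  refine ⟨TwistedPolynomial.mem_support.mp he.left_mem,
    TwistedPolynomial.mem_support.mp he.right_mem, fun j hj hj' => ?_⟩
  have hcast : ∀ v, ((-(m v)).toNat : ℚ) = -m v := fun v => by
    exact_mod_cast Int.toNat_of_nonneg (neg_nonneg.mpr (hnonpos v))
  have hslope := hs.eq_of_isEdge hβ hmonic hdeg (hc.isEdge_coeffOrder he) hle (j := j)
    (by have := hnonpos s.castSucc; omega) (by have := hnonpos s.succ; omega)
  rwa [hcast, hcast, neg_sub_neg] at hslope

theorem proposition5p6 {k : Type*} [NormedField k] [IsUltrametricDist k] [CharZero k]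
    {γ : ℝ} (hγ₀ : 0 < γ) (hγ₁ : γ < 1)
    (ℓ : TwistedPolynomial (ddx k)) (n : ℕ) (hn : 0 < n) (hdeg : ℓ.natDegree = n)
    (hmonic : ℓ.Monic) (hcoeff : ∀ i, ℓ.coeff i ∈ analyticRing k γ) :
    (∃ c : ℝ, IsSmallRadius γ ℓ c) ∧
    ∀ c : ℝ, IsSmallRadius γ ℓ c →
      (∀ ρ : ℝ, 0 < ρ → ρ ≤ c → newtonBreaks ρ ℓ = newtonBreaks c ℓ) ∧
      ∀ β : Fin n → ℚ, Antitone β →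
        IsFormalSlopes (cyclicOperator ℓ) (Finset.univ.val.map β) →
        ∀ (r : ℕ) (m : Fin (r + 1) → ℤ), StrictMono m → Set.range m = newtonBreaks c ℓ →
        ∀ t : Fin r, IsEffective c ℓ (m t.castSucc) (m t.succ) →
        ∀ s : Fin r, s ≤ t →
          ℓ.coeff (-(m s.castSucc)).toNat ≠ 0 ∧ ℓ.coeff (-(m s.succ)).toNat ≠ 0 ∧
          ∀ j : Fin n, m s.castSucc + n ≤ (j : ℕ) → ((j : ℕ) : ℤ) < m s.succ + n →
            β j = -1 - (((ℓ.coeff (-(m s.succ)).toNat).order : ℚ) -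
                ((ℓ.coeff (-(m s.castSucc)).toNat).order : ℚ)) /
              ((m s.succ : ℚ) - (m s.castSucc : ℚ)) := by
  exact proposition5p6_general hγ₀ ℓ n hdeg hmonic fun i =>
    bddAbove_of_mem_analyticRing hγ₀ (hcoeff i)
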